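/- Let $H_n=J_n-iY_n$ ($n=0,1$) be the Hankel functions of the second kind, let ${}^*$ denote complex conjugation, and for $x>0$ put $$c(x)=\sqrt{\tfrac{\pi x}{8}}\Big[\big(1+\tfrac{i}{2x}\big)H_0(x)-iH_1(x)\Big],\qquad d(x)=\sqrt{\tfrac{\pi x}{8}}\Big[\big(1+\tfrac{i}{2x}\big)H_0^*(x)-iH_1^*(x)\Big].$$ For integers $m\ge 1$ and $t,t_0>0$ let $$\alpha_m(t,t_0)=c(mt)c^*(mt_0)-d(mt)d^*(mt_0),\qquad \beta_m(t,t_0)=d(mt)c(mt_0)-c(mt)d(mt_0).$$ (1) For every $\epsilon\in(0,1]$ there is $T_\epsilon>0$ such that for all $t_0>T_\epsilon$, $\tau\in[0,\pi]$ and $m\ge1$, $$1-(\mathrm{Re}\,\alpha_m(t_0+\tau,t_0))^2\ \ge\ \sin^2(m\tau)-26\,\epsilon .$$ (2) Consequently Condition 1 holds for the Gowdy model: there are $t_0>0$ and $\delta\in(0,\pi)$ such that for every measurable $E\subset[0,\pi]$ of Lebesgue measure $>\pi-\delta$ there is $\Delta(E)>0$ with $\int_E\{1-(\mathrm{Re}\,\alpha_m(t_0+\tau,t_0))^2\}\,d\tau>\Delta(E)$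 for all $m\ge1$. (3) Consequently the Fock quantisation of the Gowdy model is unique, in the following sense. Describe real field data $(\xi,P)$ on $S^1$ without zero mode by the complex coordinates $b_n=(|n|\xi_n+iP_n)/\sqrt{2|n|}$, $n\in\mathbb Z\setminus\{0\}$ ($\xi_n,P_n$ the Fourier coefficients), with symplectic form $\Omega(v,w)=-2\sum_{n\ne0}\mathrm{Im}\big(b_n(v)^*b_n(w)\big)$, evolution $U(t,t_0): b_{\pm m}\mapsto\alpha_m(t,t_0)b_{\pm m}+\beta_m(t,t_0)b_{\mp m}^*$ ($m\ge1$), translations $T_\theta:b_n\mapsto e^{in\theta}b_n$, and reference complex structure $J_0: b_n\mapsto i\,b_n$. Let the phase space $V$ be any real vector space of square-summable sequences $(b_n)$ that contains all sequences with finitely many nonzero terms and is stable under $J_0$, all $T_\theta$ and all $U(t,t_0)$, $t,t_0>0$. A complex structure on $V$ is a real linear $J:V\to V$ with $J^2=-1$; it is compatible if $\Omega(Jv,Jw)=\Omega(v,w)$ and $\Omega(Jv,v)>0$ for $v\neq0$, and invariant if $T_\theta^{-1}JT_\theta=J$ for all $\theta$. The dynamics is unitarily implementable with respect to $J$ if the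 antilinear part $\{U(t,t_0)+JU(t,t_0)J\}/2$ is Hilbert–Schmidt for the inner product $\langle\cdot,\cdot\rangle_J=\{\Omega(J\cdot,\cdot)-i\,\Omega(\cdot,\cdot)\}/2$ for all $t,t_0>0$; the Fock representations defined by $J$ and $J_0$ are unitarily equivalent if $J-J_0$ is Hilbert–Schmidt for $\langle\cdot,\cdot\rangle_{J_0}$. Then $J_0$ is a compatible invariant complex structure with respect to which the dynamics is unitarily implementable, and for every compatible invariant complex structure $J$ on $V$ with respect to which the dynamics is unitarily implementable, the Fock representations defined by $J$ and $J_0$ are unitarily equivalent. -/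

import Mathlib

open scoped ComplexConjugate

noncomputable section

namespace Gowdy

/-! ### Bessel and Hankel functions of integer order -/

/-- Bessel function of the first kind `J_n`, by its power series. -/
def besselJ (n : ℕ) (x : ℝ) : ℝ :=
  ∑' k : ℕ, (-1) ^ k / ((k.factorial : ℝ) * ((k + n).factorial : ℝ)) * (x / 2) ^ (2 * k + n)

/-- The digamma function at a positive integer: `digammaSucc k = ψ(k + 1) = -γ + ∑_{j=1}^k 1/j`. -/
def digammaSucc (k : ℕ) : ℝ := -Real.eulerMascheroniConstant + (harmonic k : ℝ)

/-- Bessel function of the second kind `Y_n` (on `x > 0`), by its standard series. -/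
def besselY (n : ℕ) (x : ℝ) : ℝ :=
  -(1 / Real.pi) * ∑ k ∈ Finset.range n,
      ((n - k - 1).factorial : ℝ) / (k.factorial : ℝ) * (x ^ 2 / 4) ^ k / (x / 2) ^ n
    + 2 / Real.pi * Real.log (x / 2) * besselJ n x
    - (x / 2) ^ n / Real.pi * ∑' k : ℕ, (digammaSucc k + digammaSucc (n + k)) *
        (-(x ^ 2 / 4)) ^ k / ((k.factorial : ℝ) * ((n + k).factorial : ℝ))

/-- Hankel function of the second kind, `H_n = J_n - i Y_n`. -/
def hankel2 (n : ℕ) (x : ℝ) : ℂ := (besselJ n x : ℂ) - Complex.I * (besselY n x : ℂ)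

/-! ### Coefficients of the classical evolution -/

/-- `c(x) = √(πx/8) [(1 + i/(2x)) H_0(x) - i H_1(x)]`. -/
def c (x : ℝ) : ℂ :=
  (Real.sqrt (Real.pi * x / 8) : ℂ) *
    ((1 + Complex.I / (2 * (x : ℂ))) * hankel2 0 x - Complex.I * hankel2 1 x)

/-- `d(x) = √(πx/8) [(1 + i/(2x)) H_0(x)^* - i H_1(x)^*]`. -/
def d (x : ℝ) : ℂ :=
  (Real.sqrt (Real.pi * x / 8) : ℂ) *
    ((1 + Complex.I / (2 * (x : ℂ))) * conj (hankel2 0 x) - Complex.I * conj (hankel2 1 x))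

/-- `α_m(t,t₀) = c(mt) c(mt₀)^* - d(mt) d(mt₀)^*`. -/
def alpha (m : ℕ+) (t t₀ : ℝ) : ℂ :=
  c ((m : ℝ) * t) * conj (c ((m : ℝ) * t₀)) - d ((m : ℝ) * t) * conj (d ((m : ℝ) * t₀))

/-- `β_m(t,t₀) = d(mt) c(mt₀) - c(mt) d(mt₀)`. -/
def beta (m : ℕ+) (t t₀ : ℝ) : ℂ :=
  d ((m : ℝ) * t) * c ((m : ℝ) * t₀) - c ((m : ℝ) * t) * d ((m : ℝ) * t₀)

/-- Condition 1 for a family `a m t t₀` of evolution coefficients. (An integral that exceeds a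
positive number is in particular the integral of an integrable function.) -/
def Condition1 (a : ℕ+ → ℝ → ℝ → ℂ) : Prop :=
  ∃ t₀ : ℝ, 0 < t₀ ∧ ∃ δ ∈ Set.Ioo 0 Real.pi,
    ∀ E : Set ℝ, MeasurableSet E → E ⊆ Set.Icc 0 Real.pi →
      ENNReal.ofReal (Real.pi - δ) < MeasureTheory.volume E →
        ∃ Δ : ℝ, 0 < Δ ∧ ∀ m : ℕ+, Δ < ∫ τ in E, (1 - (a m (t₀ + τ) t₀).re ^ 2)

/-! ### Phase space (nonzero modes)

Real initial data `(ξ, P)` with Fourier coefficients `ξ_n, P_n` are described by the complex numbers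
`b_n = (|n| ξ_n + i P_n) / √(2|n|)`, `n ≠ 0`. They are stored as the pairs `(b_m, b_{-m})`, `m ≥ 1`;
the remaining coordinates `b_{-m}^*, b_m^*` are their complex conjugates. -/

/-- All sequences of pairs `(b_m, b_{-m})`, `m ≥ 1`, as a real vector space. -/
abbrev Modes : Type := ℕ+ → ℂ × ℂ

/-- The symplectic form `Ω(v,w) = i ∑_{n ≠ 0} (b_n(v)^* b_n(w) - b_n(v) b_n(w)^*)`, which is
`∮ (ξ_w P_v - ξ_v P_w) dθ` for the fields with these mode coefficients. -/
def symp (v w : Modes) : ℝ :=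
  ∑' m : ℕ+, (-2) * ((conj (v m).1 * (w m).1).im + (conj (v m).2 * (w m).2).im)

/-- The translation `T_θ`: `b_m ↦ e^{imθ} b_m`, `b_{-m} ↦ e^{-imθ} b_{-m}`. -/
def translation (θ : ℝ) : Modes →ₗ[ℝ] Modes where
  toFun v m := (Complex.exp (Complex.I * ((m : ℝ) * θ : ℝ)) * (v m).1,
    Complex.exp (-(Complex.I * ((m : ℝ) * θ : ℝ))) * (v m).2)
  map_add' v w := by
    funext m
    simp [mul_add]
  map_smul' r v := by
    funext m
    simp [mul_left_comm]

/-- The complex structure `J₀ = diag(i, -i, i, -i)` in the coordinates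
`(b_m, b_{-m}^*, b_{-m}, b_m^*)`. -/
def J0 : Modes →ₗ[ℝ] Modes where
  toFun v m := (Complex.I * (v m).1, Complex.I * (v m).2)
  map_add' v w := by
    funext m
    simp [mul_add]
  map_smul' r v := by
    funext m
    simp [mul_left_comm]

/-- The classical evolution `U(t,t₀)`:
`b_m ↦ α_m b_m + β_m b_{-m}^*`, `b_{-m} ↦ α_m b_{-m} + β_m b_m^*`. -/
def evolution (t t₀ : ℝ) : Modes →ₗ[ℝ] Modes where
  toFun v m := (alpha m t t₀ * (v m).1 + beta m t t₀ * conj (v m).2,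
    alpha m t t₀ * (v m).2 + beta m t t₀ * conj (v m).1)
  map_add' v w := by
    funext m
    ext1 <;> simp <;> ring
  map_smul' r v := by
    funext m
    ext1 <;> simp <;> ring

/-- Admissible linear phase spaces: real vector spaces of mode sequences which contain all data with
finitely many modes, consist of square summable sequences (so that the symplectic form converges) and
are stable under `J₀`, the translations and the evolution. The function space of the field data
is not otherwise restricted (e.g. trigonometric polynomials, smooth fields). -/
structure IsPhaseSpace (V : Submodule ℝ Modes) : Prop where
  single_mem : ∀ (m : ℕ+) (z : ℂ × ℂ), (Pi.single m z : Modes) ∈ V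
  summable : ∀ v ∈ V, Summable fun m : ℕ+ => ‖(v m).1‖ ^ 2 + ‖(v m).2‖ ^ 2
  J0_mem : ∀ v ∈ V, J0 v ∈ V
  translation_mem : ∀ θ : ℝ, ∀ v ∈ V, translation θ v ∈ V
  evolution_mem : ∀ t t₀ : ℝ, 0 < t → 0 < t₀ → ∀ v ∈ V, evolution t t₀ v ∈ V

/-- `J₀` as an operator on the phase space `V`. -/
def IsPhaseSpace.J0 {V : Submodule ℝ Modes} (hV : IsPhaseSpace V) : V →ₗ[ℝ] V :=
  Gowdy.J0.restrict hV.J0_mem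

/-- The translation `T_θ` as an operator on the phase space `V`. -/
def IsPhaseSpace.translation {V : Submodule ℝ Modes} (hV : IsPhaseSpace V) (θ : ℝ) :
    V →ₗ[ℝ] V :=
  (Gowdy.translation θ).restrict (hV.translation_mem θ)

/-- The evolution `U(t,t₀)`, for positive times, as an operator on the phase space `V`. -/
def IsPhaseSpace.evolution {V : Submodule ℝ Modes} (hV : IsPhaseSpace V) (t t₀ : ℝ)
    (ht : 0 < t) (ht₀ : 0 < t₀) : V →ₗ[ℝ] V :=
  (Gowdy.evolution t t₀).restrict (hV.evolution_mem t t₀ ht ht₀)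

/-! ### Complex structures and the Hilbert-Schmidt conditions -/

/-- A complex structure compatible with the symplectic form. -/
structure IsCompatible {V : Submodule ℝ Modes} (J : V →ₗ[ℝ] V) : Prop where
  sq : ∀ v : V, J (J v) = -v
  symp_eq : ∀ v w : V, symp (J v : Modes) (J w : Modes) = symp (v : Modes) (w : Modes)
  pos : ∀ v : V, v ≠ 0 → 0 < symp (J v : Modes) (v : Modes)

/-- Invariance of `J` under all translations. -/
def IsInvariant {V : Submodule ℝ Modes} (hV : IsPhaseSpace V) (J : V →ₗ[ℝ] V) : Prop :=
  ∀ (θ : ℝ) (v : V), hV.translation (-θ) (J (hV.translation θ v)) = J v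

/-- The real part `Ω(J·,·)/2` of the inner product `⟨·,·⟩_J = (Ω(J·,·) - iΩ(·,·))/2`. -/
def innerRe {V : Submodule ℝ Modes} (J : V →ₗ[ℝ] V) (v w : V) : ℝ :=
  symp (J v : Modes) (w : Modes) / 2

/-- The real linear operator `A` on `V` is Hilbert-Schmidt with respect to the inner product defined
by `J` (equivalently: it extends to a Hilbert-Schmidt operator on the completion of `V`): the sums
`∑ ‖A e_i‖²` over finite orthonormal families are bounded. For complex antilinear operators this
is the same as being Hilbert-Schmidt on the complex one-particle space. -/
def IsHilbertSchmidt {V : Submodule ℝ Modes} (J A : V →ₗ[ℝ] V) : Prop :=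
  ∃ C : ℝ, ∀ (n : ℕ) (e : Fin n → V),
    (∀ i j, innerRe J (e i) (e j) = if i = j then 1 else 0) →
      ∑ i, innerRe J (A (e i)) (A (e i)) ≤ C

/-- The antilinear part `(A + J A J)/2` of `A` with respect to `J`. -/
def antilinearPart {V : Submodule ℝ Modes} (J A : V →ₗ[ℝ] V) : V →ₗ[ℝ] V :=
  (1 / 2 : ℝ) • (A + J ∘ₗ A ∘ₗ J)

/-- The dynamics is unitarily implementable in the Fock representation defined by `J`: the antilinear
part of `U(t,t₀)` is Hilbert-Schmidt for `⟨·,·⟩_J`, for all positive `t, t₀`. -/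
def DynamicsImplementable {V : Submodule ℝ Modes} (hV : IsPhaseSpace V) (J : V →ₗ[ℝ] V) : Prop :=
  ∀ (t t₀ : ℝ) (ht : 0 < t) (ht₀ : 0 < t₀),
    IsHilbertSchmidt J (antilinearPart J (hV.evolution t t₀ ht ht₀))

/-- The Fock representations defined by `J` and `J₀` are unitarily equivalent: `J - J₀` is
Hilbert-Schmidt on the one-particle space of `J₀`. -/
def FockEquivalentToJ0 {V : Submodule ℝ Modes} (hV : IsPhaseSpace V) (J : V →ₗ[ℝ] V) : Prop :=
  IsHilbertSchmidt hV.J0 (J - hV.J0)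

end Gowdy

end

namespace Gowdy

open Filter Topology MeasureTheory Set

/-! ### Power series -/

/-! Everything rests on the asymptotics c(x) = w e^{-ix} + O(1/x) with |w| = 1 and d(x) = O(1/x)
(`exists_asymptotics`). They are read off from the representation H_0(x) = (2i/π) ∫_0^∞ 2 (v² +
2i)^{-1/2} e^{-x(v² + i)} dv and its derivative, by replacing the density by its value at v = 0. To
tie the series defining J and Y to these integrals, both pairs (H_0, H_1) are shown to solve f' =
-g, g' = f - g/x. The logarithmic singularity at the origin is matched down to its constant term,
where Euler's constant enters through Γ'(1) = -γ. An energy argument (`bessel_system_unique`) then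
gives equality (`hankel2_eq`).

Since m t ≥ t, the errors are uniform in m: α_m(t₀ + τ, t₀) = e^{-imτ} + O(1/t₀). This yields the
first claim. Condition 1 follows because the integral of sin²(mτ) over E is at least |E| minus the
full integral π/2 of cos²(mτ), whatever m is.

For uniqueness, translation invariance forces J to act on each pair (b_m, b_{-m}) separately, and
compatibility leaves one hyperbolic parameter (κ, l) with κ² = 1 + |l|² per pair
(`IsCompatible.exists_pairJ`). Testing the Hilbert-Schmidt condition on suitable orthonormal vectors
shows that the antilinear coefficients `conjBeta` are square summable. As β_m = O(1/m) is square
summable too, so is (|l_m|/κ_m) Im α_m for every τ. The same averaging estimate as in Condition 1,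
now applied to (Im α_m)² ≈ sin²(mτ) on a large set of τ where the sum is bounded, removes the factor
Im α_m (`summable_of_forall_summable_mul`). Then l_m tends to 0, the sum of |l_m|² is finite, and
this is the Hilbert-Schmidt property of J - J₀. -/

theorem hasDerivAt_congr {E : Type*} [NormedAddCommGroup E] [NormedSpace ℝ E] {f g : ℝ → E}
    {f' g' : E} {x : ℝ} (h : HasDerivAt f f' x) (hf : ∀ y, g y = f y) (hd : f' = g') :
    HasDerivAt g g' x := by
  rw [funext hf, ← hd]
  exact h

/-- The sum of the real power series with coefficients `a`. -/
noncomputable def seriesSum (a : ℕ → ℝ) (z : ℝ) : ℝ := ∑' k, a k * z ^ k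

theorem summable_series {a : ℕ → ℝ} {C : ℝ} (ha : ∀ k, |a k| ≤ C / k.factorial) (z : ℝ) :
    Summable fun k => a k * z ^ k := by
  refine Summable.of_norm_bounded ((Real.summable_pow_div_factorial |z|).mul_left C) fun k => ?_
  rw [norm_mul, norm_pow, Real.norm_eq_abs, Real.norm_eq_abs]
  calc |a k| * |z| ^ k ≤ C / k.factorial * |z| ^ k := by gcongr; exact ha k
    _ = C * (|z| ^ k / k.factorial) := by ring

theorem hasDerivAt_seriesSum {a : ℕ → ℝ} {C : ℝ} (ha : ∀ k, |a k| ≤ C / k.factorial) (z : ℝ) :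
    HasDerivAt (seriesSum a) (seriesSum (fun k => (k + 1) * a (k + 1)) z) z := by
  set R := |z| + 1
  have hR : 0 ≤ R := by positivity
  have hu : Summable fun k : ℕ => C / k.factorial * (k * R ^ (k - 1)) := by
    -- The truncated exponent `k - 1` is harmless at k = 0, where the factor k vanishes; after the
    -- shift the majorant is C R^k / k!.
    rw [← summable_nat_add_iff 1]
    refine ((Real.summable_pow_div_factorial R).mul_left C).congr fun k => ?_
    have : ((k + 1).factorial : ℝ) = (k + 1) * k.factorial := by
      rw [Nat.factorial_succ]; push_cast; ring
    have h2 : (k.factorial : ℝ) ≠ 0 := by positivity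
    rw [this]
    push_cast
    field_simp
  have h1 : HasDerivAt (seriesSum a) (∑' k : ℕ, a k * (k * z ^ (k - 1))) z := by
    refine hasDerivAt_tsum_of_isPreconnected (t := Metric.ball 0 R) (y₀ := z)
      (g := fun k y => a k * y ^ k) (g' := fun k y => a k * (k * y ^ (k - 1))) hu Metric.isOpen_ball
      (convex_ball _ _).isPreconnected (fun k y _ => ?_) (fun k y hy => ?_) ?_ (summable_series ha z) ?_
    · exact (hasDerivAt_pow k y).const_mul (a k)
    · rw [norm_mul, norm_mul, norm_pow, Real.norm_eq_abs, Real.norm_eq_abs, Real.norm_eq_abs,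
        Nat.abs_cast]
      have hy' : |y| ≤ R := by simpa using (mem_ball_zero_iff.1 hy).le
      gcongr
      · exact (abs_nonneg _).trans (ha k)
      · exact ha k
    · simp [R]
    · simp [R]
  convert h1 using 1
  have hs : Summable fun k : ℕ => a k * (k * z ^ (k - 1)) := by
    refine Summable.of_norm_bounded hu fun k => ?_
    rw [norm_mul, norm_mul, norm_pow, Real.norm_eq_abs, Real.norm_eq_abs, Real.norm_eq_abs,
      Nat.abs_cast]
    gcongr
    · exact (abs_nonneg _).trans (ha k)
    · exact ha k
    · exact (lt_add_one _).le
  rw [hs.tsum_eq_zero_add]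
  simp only [seriesSum, Nat.add_sub_cancel]
  push_cast
  simp only [zero_mul, mul_zero, zero_add]
  exact tsum_congr fun k => by ring

/-- Multiplication by z shifts the coefficients, so differentiation produces the factor k + 1
without moving the index. This is the form suited to x J_1 and x Y_1. -/
theorem hasDerivAt_mul_seriesSum {a : ℕ → ℝ} {C : ℝ}
    (ha : ∀ k : ℕ, |(k + 1) * a k| ≤ C / k.factorial) (z : ℝ) :
    HasDerivAt (fun z => z * seriesSum a z) (seriesSum (fun k => (k + 1) * a k) z) z := by
  have hC : 0 ≤ C := by simpa using (abs_nonneg _).trans (ha 0)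
  have hk (k : ℕ) : |a k| ≤ C / (k + 1).factorial := by
    have h := ha k
    rw [abs_mul, abs_of_nonneg (by positivity : (0 : ℝ) ≤ k + 1)] at h
    rw [Nat.factorial_succ, Nat.cast_mul, mul_comm, ← div_div, le_div_iff₀ (by positivity)]
    push_cast
    linarith
  let b : ℕ → ℝ := fun k => k.casesOn 0 a
  have hb : ∀ k, |b k| ≤ C / k.factorial := by
    rintro (_ | k)
    · simpa [b] using hC
    · exact hk k
  have h := hasDerivAt_seriesSum hb z
  refine hasDerivAt_congr h (fun z => ?_) rfl
  rw [seriesSum, seriesSum, (summable_series hb z).tsum_eq_zero_add, ← tsum_mul_left]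
  change _ = (0 : ℝ) * z ^ 0 + ∑' k, a k * z ^ (k + 1)
  rw [zero_mul, zero_add]
  exact tsum_congr fun k => by ring

theorem seriesSum_add {a b : ℕ → ℝ} {C D : ℝ} (ha : ∀ k, |a k| ≤ C / k.factorial)
    (hb : ∀ k, |b k| ≤ D / k.factorial) (z : ℝ) :
    seriesSum (fun k => a k + b k) z = seriesSum a z + seriesSum b z := by
  rw [seriesSum, seriesSum, seriesSum, ← (summable_series ha z).tsum_add (summable_series hb z)]
  exact tsum_congr fun k => by ring

theorem seriesSum_zero (a : ℕ → ℝ) : seriesSum a 0 = a 0 := by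
  rw [seriesSum, tsum_eq_single 0]
  · simp
  · intro k hk
    simp [hk]

/-! ### The Bessel functions as power series -/

/-- Coefficients of `z ↦ (x/2)^{-n} J_n(x)`, `z = x²/4`. -/
noncomputable def coeffJ (n k : ℕ) : ℝ := (-1) ^ k / ((k.factorial : ℝ) * ((k + n).factorial : ℝ))

/-- Coefficients of the regular series in `Y_n`, in powers of `z = x²/4`. -/
noncomputable def coeffY (n k : ℕ) : ℝ :=
  (digammaSucc k + digammaSucc (n + k)) * (-1) ^ k / ((k.factorial : ℝ) * ((n + k).factorial : ℝ))

theorem besselJ_eq (n : ℕ) (x : ℝ) :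
    besselJ n x = (x / 2) ^ n * seriesSum (coeffJ n) (x ^ 2 / 4) := by
  rw [besselJ, seriesSum, ← tsum_mul_left]
  refine tsum_congr fun k => ?_
  rw [coeffJ, pow_add, pow_mul, show (x / 2) ^ 2 = x ^ 2 / 4 by ring]
  ring

theorem besselY_zero_eq (x : ℝ) :
    besselY 0 x = 2 / Real.pi * Real.log (x / 2) * besselJ 0 x
      - 1 / Real.pi * seriesSum (coeffY 0) (x ^ 2 / 4) := by
  rw [besselY, seriesSum]
  simp only [Finset.range_zero, Finset.sum_empty, mul_zero, zero_add, pow_zero]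
  congr 2
  refine tsum_congr fun k => ?_
  rw [coeffY, neg_pow]
  simp only [zero_add]
  ring

/-- The factor x turns the finite sum of Y_1 into the constant -2/π, leaving no pole. -/
theorem besselY_one_eq {x : ℝ} (hx : 0 < x) :
    x * besselY 1 x = -(2 / Real.pi) + 2 / Real.pi * Real.log (x / 2) * (x * besselJ 1 x)
      - 2 / Real.pi * (x ^ 2 / 4 * seriesSum (coeffY 1) (x ^ 2 / 4)) := by
  rw [besselY, seriesSum]
  have h : ∑' k : ℕ, (digammaSucc k + digammaSucc (1 + k)) *
        (-(x ^ 2 / 4)) ^ k / ((k.factorial : ℝ) * ((1 + k).factorial : ℝ)) =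
      ∑' k, coeffY 1 k * (x ^ 2 / 4) ^ k := by
    refine tsum_congr fun k => ?_
    rw [coeffY, neg_pow (x ^ 2 / 4)]
    ring
  rw [h]
  simp only [Finset.range_one, Finset.sum_singleton, Nat.factorial_zero, Nat.cast_one, pow_zero,
    pow_one, Nat.sub_zero, Nat.sub_self]
  field_simp
  ring

theorem abs_coeffJ_le (n k : ℕ) : |coeffJ n k| ≤ 1 / k.factorial := by
  have h1 : (1 : ℝ) ≤ (k + n).factorial := by exact_mod_cast Nat.factorial_pos _
  have h2 : (0 : ℝ) < k.factorial := by exact_mod_cast Nat.factorial_pos _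
  rw [coeffJ, abs_div, abs_pow, abs_neg, abs_one, one_pow, abs_of_pos (by positivity)]
  gcongr
  nlinarith

theorem abs_digammaSucc_le (k : ℕ) : |digammaSucc k| ≤ k + 1 := by
  have h0 : 0 < Real.eulerMascheroniConstant := by
    linarith [Real.one_half_lt_eulerMascheroniConstant]
  have h1 : Real.eulerMascheroniConstant < 1 := by
    linarith [Real.eulerMascheroniConstant_lt_two_thirds]
  have h2 : (0 : ℝ) ≤ (harmonic k : ℝ) ∧ (harmonic k : ℝ) ≤ k := by
    induction k with
    | zero => simp
    | succ k ih =>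
      rw [harmonic_succ]
      push_cast
      have : ((k : ℝ) + 1)⁻¹ ≤ 1 := inv_le_one_of_one_le₀ (by linarith [k.cast_nonneg (α := ℝ)])
      have : 0 < ((k : ℝ) + 1)⁻¹ := by positivity
      constructor <;> linarith
  rw [digammaSucc, abs_le]
  constructor <;> linarith

theorem digammaSucc_succ (k : ℕ) : digammaSucc (k + 1) = digammaSucc k + 1 / (k + 1) := by
  rw [digammaSucc, digammaSucc, harmonic_succ]
  push_cast
  ring

theorem cast_le_factorial (k : ℕ) : (k : ℝ) ≤ k.factorial := by
  exact_mod_cast Nat.self_le_factorial k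

theorem one_le_factorial (k : ℕ) : (1 : ℝ) ≤ k.factorial := by
  exact_mod_cast Nat.factorial_pos k

/-- One of the two factorials absorbs the linear growth of the digamma factor. -/
theorem abs_coeffY_zero_le (k : ℕ) : |coeffY 0 k| ≤ 4 / k.factorial := by
  rw [coeffY, abs_div, abs_mul, abs_pow, abs_neg, abs_one, one_pow, mul_one, zero_add,
    abs_of_pos (by positivity : (0 : ℝ) < (k.factorial : ℝ) * k.factorial), ← div_div]
  gcongr
  rw [div_le_iff₀ (by positivity)]
  have h := abs_add_le (digammaSucc k) (digammaSucc k)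
  linarith [abs_digammaSucc_le k, cast_le_factorial k, one_le_factorial k]

/-- This and the next three recursions are the coefficient form of H_0' = -H_1 and (x H_1)' = x H_0.
In those for Y the extra J terms come from ψ(k+2) - ψ(k+1) = 1/(k+1); they cancel against the
derivative of the logarithm. -/
theorem succ_mul_coeffJ_one (k : ℕ) : (k + 1) * coeffJ 1 k = coeffJ 0 k := by
  rw [coeffJ, coeffJ, Nat.factorial_succ]
  push_cast
  simp only [add_zero]
  have : (k.factorial : ℝ) ≠ 0 := by positivity
  field_simp

theorem succ_mul_coeffJ_zero_succ (k : ℕ) : (k + 1) * coeffJ 0 (k + 1) = -coeffJ 1 k := by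
  rw [coeffJ, coeffJ]
  simp only [add_zero]
  rw [Nat.factorial_succ]
  push_cast
  have : (k.factorial : ℝ) ≠ 0 := by positivity
  rw [pow_succ]
  field_simp

theorem succ_mul_coeffY_one (k : ℕ) : (k + 1) * coeffY 1 k = coeffY 0 k + coeffJ 1 k := by
  rw [coeffJ, coeffY, coeffY, add_comm 1 k, Nat.factorial_succ, digammaSucc_succ]
  push_cast
  simp only [zero_add]
  have : (k.factorial : ℝ) ≠ 0 := by positivity
  field_simp
  ring

theorem succ_mul_coeffY_zero_succ (k : ℕ) :
    (k + 1) * coeffY 0 (k + 1) = -coeffY 1 k + coeffJ 0 (k + 1) := by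
  rw [coeffJ, coeffY, coeffY, add_comm 1 k]
  simp only [zero_add, add_zero]
  rw [Nat.factorial_succ, digammaSucc_succ]
  push_cast
  have : (k.factorial : ℝ) ≠ 0 := by positivity
  rw [pow_succ]
  field_simp
  ring

theorem hasDerivAt_quarter_sq (x : ℝ) : HasDerivAt (fun x : ℝ => x ^ 2 / 4) (x / 2) x := by
  refine hasDerivAt_congr ((hasDerivAt_pow 2 x).div_const 4) (fun _ => rfl) ?_
  norm_num
  ring

theorem hasDerivAt_besselJ_zero (x : ℝ) : HasDerivAt (besselJ 0) (-besselJ 1 x) x := by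
  have h := (hasDerivAt_seriesSum (abs_coeffJ_le 0) (x ^ 2 / 4)).comp x (hasDerivAt_quarter_sq x)
  refine hasDerivAt_congr h (fun x => by simp [besselJ_eq]) ?_
  rw [besselJ_eq, pow_one]
  simp only [succ_mul_coeffJ_zero_succ, seriesSum, neg_mul, tsum_neg]
  ring

theorem hasDerivAt_mul_besselJ_one (x : ℝ) :
    HasDerivAt (fun x => x * besselJ 1 x) (x * besselJ 0 x) x := by
  have hb : ∀ k : ℕ, |(k + 1) * coeffJ 1 k| ≤ 1 / k.factorial := fun k => by
    rw [succ_mul_coeffJ_one]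
    exact abs_coeffJ_le 0 k
  have h := ((hasDerivAt_mul_seriesSum hb (x ^ 2 / 4)).comp x (hasDerivAt_quarter_sq x)).const_mul 2
  refine hasDerivAt_congr h (fun x => ?_) ?_
  · simp only [Function.comp, besselJ_eq]
    ring
  · simp only [succ_mul_coeffJ_one, besselJ_eq]
    ring

theorem abs_succ_mul_coeffY_one_le (k : ℕ) : |(k + 1) * coeffY 1 k| ≤ 5 / k.factorial := by
  rw [succ_mul_coeffY_one]
  refine (abs_add_le _ _).trans ?_
  have := abs_coeffY_zero_le k
  have := abs_coeffJ_le 1 k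
  rw [show (5 : ℝ) / k.factorial = 4 / k.factorial + 1 / k.factorial by ring]
  linarith

theorem abs_coeffY_one_le (k : ℕ) : |coeffY 1 k| ≤ 5 / k.factorial := by
  refine le_trans ?_ (abs_succ_mul_coeffY_one_le k)
  rw [abs_mul, abs_of_nonneg (by positivity : (0 : ℝ) ≤ k + 1)]
  exact le_mul_of_one_le_left (abs_nonneg _) (by linarith [k.cast_nonneg (α := ℝ)])

theorem hasDerivAt_log_half {x : ℝ} (hx : 0 < x) :
    HasDerivAt (fun x => Real.log (x / 2)) (1 / x) x := by
  refine hasDerivAt_congr (((hasDerivAt_id x).div_const 2).log (by simpa using hx.ne'))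
    (fun _ => rfl) ?_
  simp only [id]
  field_simp

/-- The constant 1 lost in the shift is what produces the pole of Y_1 when Y_0 is differentiated.
The identity also shows that J_0 - 1 vanishes to second order at the origin. -/
theorem mul_seriesSum_coeffJ_succ (z : ℝ) :
    z * seriesSum (fun k => coeffJ 0 (k + 1)) z = seriesSum (coeffJ 0) z - 1 := by
  rw [seriesSum, seriesSum, (summable_series (abs_coeffJ_le 0) z).tsum_eq_zero_add, ← tsum_mul_left]
  simp only [coeffJ, pow_zero, Nat.factorial_zero, Nat.cast_one, add_zero, mul_one, div_one]
  rw [add_sub_cancel_left]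
  exact tsum_congr fun k => by ring

theorem hasDerivAt_besselY_zero {x : ℝ} (hx : 0 < x) :
    HasDerivAt (besselY 0) (-besselY 1 x) x := by
  have h1 := (hasDerivAt_seriesSum abs_coeffY_zero_le (x ^ 2 / 4)).comp x (hasDerivAt_quarter_sq x)
  have h2 := (((hasDerivAt_log_half hx).mul (hasDerivAt_besselJ_zero x)).const_mul
    (2 / Real.pi)).sub (h1.const_mul (1 / Real.pi))
  have he : besselY 0 = fun x => 2 / Real.pi * (Real.log (x / 2) * besselJ 0 x)
      - 1 / Real.pi * seriesSum (coeffY 0) (x ^ 2 / 4) := by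
    funext x
    rw [besselY_zero_eq]
    ring
  rw [he]
  refine h2.congr_deriv ?_
  have h3 : seriesSum (fun k => (k + 1) * coeffY 0 (k + 1)) (x ^ 2 / 4) =
      -seriesSum (coeffY 1) (x ^ 2 / 4) + seriesSum (fun k => coeffJ 0 (k + 1)) (x ^ 2 / 4) := by
    have ha : ∀ k, |-coeffY 1 k| ≤ 5 / k.factorial := fun k => by
      rw [abs_neg]
      exact abs_coeffY_one_le k
    have hb : ∀ k : ℕ, |coeffJ 0 (k + 1)| ≤ 1 / k.factorial := fun k =>
      (abs_coeffJ_le 0 (k + 1)).trans (by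
        gcongr
        exact Nat.le_succ k)
    simp only [succ_mul_coeffY_zero_succ]
    rw [seriesSum_add ha hb]
    simp only [seriesSum, neg_mul, tsum_neg]
  have h4 := mul_seriesSum_coeffJ_succ (x ^ 2 / 4)
  have h5 : besselJ 0 x = seriesSum (coeffJ 0) (x ^ 2 / 4) := by simp [besselJ_eq]
  rw [h3]
  refine mul_left_cancel₀ hx.ne' ?_
  rw [mul_neg x (besselY 1 x), besselY_one_eq hx]
  rw [← h5] at h4
  have hp := Real.pi_pos.ne'
  field_simp
  linear_combination (-16) * h4

theorem hasDerivAt_mul_besselY_one {x : ℝ} (hx : 0 < x) :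
    HasDerivAt (fun x => x * besselY 1 x) (x * besselY 0 x) x := by
  have h1 := (hasDerivAt_mul_seriesSum abs_succ_mul_coeffY_one_le (x ^ 2 / 4)).comp x
    (hasDerivAt_quarter_sq x)
  have h2 := ((((hasDerivAt_log_half hx).mul (hasDerivAt_mul_besselJ_one x)).const_mul
    (2 / Real.pi)).sub (h1.const_mul (2 / Real.pi))).const_add (-(2 / Real.pi))
  have he : (fun x => x * besselY 1 x) =ᶠ[𝓝 x] fun x => -(2 / Real.pi) +
      (2 / Real.pi * (Real.log (x / 2) * (x * besselJ 1 x))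
      - 2 / Real.pi * (x ^ 2 / 4 * seriesSum (coeffY 1) (x ^ 2 / 4))) := by
    filter_upwards [lt_mem_nhds hx] with y hy
    rw [besselY_one_eq hy]
    ring
  refine HasDerivAt.congr_of_eventuallyEq (h2.congr_deriv ?_) he
  have h3 : seriesSum (fun k => (k + 1) * coeffY 1 k) (x ^ 2 / 4) =
      seriesSum (coeffY 0) (x ^ 2 / 4) + seriesSum (coeffJ 1) (x ^ 2 / 4) := by
    simp only [succ_mul_coeffY_one]
    exact seriesSum_add abs_coeffY_zero_le (abs_coeffJ_le 1) _
  rw [h3, besselY_zero_eq, besselJ_eq 1]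
  have hp := Real.pi_pos.ne'
  field_simp
  ring

/-! ### The Hankel functions: differential equations and behaviour at the origin -/

theorem hasDerivAt_hankel2_zero {x : ℝ} (hx : 0 < x) :
    HasDerivAt (hankel2 0) (-hankel2 1 x) x := by
  refine hasDerivAt_congr ((hasDerivAt_besselJ_zero x).ofReal_comp.sub
    ((hasDerivAt_besselY_zero hx).ofReal_comp.const_mul Complex.I)) (fun _ => rfl) ?_
  rw [hankel2]
  push_cast
  ring

theorem hasDerivAt_of_hasDerivAt_mul {f : ℝ → ℂ} {g : ℂ} {x : ℝ} (hx : 0 < x)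
    (h : HasDerivAt (fun x : ℝ => (x : ℂ) * f x) (x * g) x) : HasDerivAt f (g - f x / x) x := by
  have hx' : (x : ℂ) ≠ 0 := by exact_mod_cast hx.ne'
  have h2 := h.div (hasDerivAt_id x).ofReal_comp hx'
  have he : f =ᶠ[𝓝 x] fun x : ℝ => (x : ℂ) * f x / (x : ℂ) := by
    filter_upwards [lt_mem_nhds hx] with y hy
    have : (y : ℂ) ≠ 0 := by exact_mod_cast hy.ne'
    field_simp
  refine HasDerivAt.congr_of_eventuallyEq (h2.congr_deriv ?_) he
  simp only [id, Complex.ofReal_one]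
  field_simp

theorem hasDerivAt_hankel2_one {x : ℝ} (hx : 0 < x) :
    HasDerivAt (hankel2 1) (hankel2 0 x - hankel2 1 x / x) x := by
  refine hasDerivAt_of_hasDerivAt_mul hx ?_
  refine hasDerivAt_congr ((hasDerivAt_mul_besselJ_one x).ofReal_comp.sub
    ((hasDerivAt_mul_besselY_one hx).ofReal_comp.const_mul Complex.I)) (fun y => ?_) ?_
  · simp only [hankel2, Pi.sub_apply]
    push_cast
    ring
  · rw [hankel2]
    push_cast
    ring

theorem tendsto_log_half_mul : Tendsto (fun x : ℝ => Real.log (x / 2) * x) (𝓝[>] 0) (𝓝 0) := by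
  have h1 : Tendsto (fun x : ℝ => Real.log x * x) (𝓝[>] 0) (𝓝 0) := by
    simpa using tendsto_log_mul_rpow_nhdsGT_zero zero_lt_one
  have h2 : Tendsto (fun x : ℝ => Real.log 2 * x) (𝓝[>] 0) (𝓝 0) := by
    have : Tendsto (fun x : ℝ => Real.log 2 * x) (𝓝 0) (𝓝 (Real.log 2 * 0)) :=
      Continuous.tendsto (by fun_prop) 0
    rw [mul_zero] at this
    exact this.mono_left nhdsWithin_le_nhds
  have h3 := h1.sub h2
  rw [sub_zero] at h3
  refine h3.congr' ?_
  filter_upwards [self_mem_nhdsWithin] with x hx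
  rw [Real.log_div (ne_of_gt hx) two_ne_zero]
  ring

theorem continuous_besselJ_zero : Continuous (besselJ 0) :=
  continuous_iff_continuousAt.2 fun x => (hasDerivAt_besselJ_zero x).continuousAt

theorem continuous_seriesSum {a : ℕ → ℝ} {C : ℝ} (ha : ∀ k, |a k| ≤ C / k.factorial) :
    Continuous (seriesSum a) :=
  continuous_iff_continuousAt.2 fun x => (hasDerivAt_seriesSum ha x).continuousAt

/-- The constant term matters: uniqueness needs the difference from the integral representation to
tend to zero, not merely to stay bounded. The leftover log(x/2) (J_0 - 1) vanishes in the limit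
because J_0 - 1 = O(x²). -/
theorem tendsto_hankel2_zero_sub_log : Tendsto (fun x : ℝ => hankel2 0 x +
    2 * Complex.I / Real.pi * Real.log (x / 2)) (𝓝[>] 0)
    (𝓝 (1 - 2 * Complex.I / Real.pi * Real.eulerMascheroniConstant)) := by
  have h1 : Tendsto (fun x : ℝ => Real.log (x / 2) * x *
      (x / 4 * seriesSum (fun k => coeffJ 0 (k + 1)) (x ^ 2 / 4))) (𝓝[>] 0) (𝓝 0) := by
    have hb : ∀ k : ℕ, |coeffJ 0 (k + 1)| ≤ 1 / k.factorial := fun k =>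
      (abs_coeffJ_le 0 (k + 1)).trans (by
        gcongr
        exact Nat.le_succ k)
    have hc : Continuous fun x : ℝ => x / 4 * seriesSum (fun k => coeffJ 0 (k + 1)) (x ^ 2 / 4) :=
      (by fun_prop : Continuous fun x : ℝ => x / 4).mul
        ((continuous_seriesSum hb).comp (by fun_prop))
    have := tendsto_log_half_mul.mul ((hc.tendsto 0).mono_left nhdsWithin_le_nhds)
    simpa using this
  have hc : Continuous fun x : ℝ => ((besselJ 0 x : ℝ) : ℂ) +
      Complex.I / Real.pi * (seriesSum (coeffY 0) (x ^ 2 / 4) : ℝ) := by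
    have := continuous_besselJ_zero
    have := (continuous_seriesSum abs_coeffY_zero_le).comp (by fun_prop : Continuous fun x : ℝ => x ^ 2 / 4)
    simp only [Function.comp_def] at this
    fun_prop
  have h2 := ((hc.tendsto 0).mono_left (nhdsWithin_le_nhds (s := Ioi (0 : ℝ)))).sub
    (((Complex.continuous_ofReal.tendsto 0).comp h1).const_mul (2 * Complex.I / (Real.pi : ℂ)))
  have he : ((besselJ 0 0 : ℝ) : ℂ) +
      Complex.I / Real.pi * (seriesSum (coeffY 0) (0 ^ 2 / 4) : ℝ) -
      2 * Complex.I / (Real.pi : ℂ) * ((0 : ℝ) : ℂ) =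
      1 - 2 * Complex.I / Real.pi * Real.eulerMascheroniConstant := by
    rw [besselJ_eq, zero_pow two_ne_zero, zero_div (4 : ℝ), seriesSum_zero, seriesSum_zero]
    simp [coeffJ, coeffY, digammaSucc]
    ring
  rw [he] at h2
  refine h2.congr fun x => ?_
  have h4 := mul_seriesSum_coeffJ_succ (x ^ 2 / 4)
  have h5 : besselJ 0 x = seriesSum (coeffJ 0) (x ^ 2 / 4) := by simp [besselJ_eq]
  rw [← h5] at h4
  have h6 : Real.log (x / 2) * x * (x / 4 * seriesSum (fun k => coeffJ 0 (k + 1)) (x ^ 2 / 4)) =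
    Real.log (x / 2) * (besselJ 0 x - 1) := by rw [← h4]; ring
  simp only [Function.comp, h6, hankel2, besselY_zero_eq]
  push_cast
  ring

theorem tendsto_mul_hankel2_one : Tendsto (fun x : ℝ => (x : ℂ) * hankel2 1 x) (𝓝[>] 0)
    (𝓝 (2 * Complex.I / Real.pi)) := by
  have hc1 : Continuous fun x : ℝ => x * besselJ 1 x :=
    continuous_iff_continuousAt.2 fun x => (hasDerivAt_mul_besselJ_one x).continuousAt
  have hc2 : Continuous fun x : ℝ => seriesSum (coeffY 1) (x ^ 2 / 4) :=
    (continuous_seriesSum abs_coeffY_one_le).comp (by fun_prop)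
  have hc3 : Continuous fun x : ℝ => seriesSum (coeffJ 1) (x ^ 2 / 4) :=
    (continuous_seriesSum (abs_coeffJ_le 1)).comp (by fun_prop)
  have h1 : Tendsto (fun x : ℝ => Real.log (x / 2) * x *
      (x / 2 * seriesSum (coeffJ 1) (x ^ 2 / 4))) (𝓝[>] 0) (𝓝 0) := by
    have hc : Continuous fun x : ℝ => x / 2 * seriesSum (coeffJ 1) (x ^ 2 / 4) := by fun_prop
    have := tendsto_log_half_mul.mul ((hc.tendsto 0).mono_left nhdsWithin_le_nhds)
    simpa using this
  have hc : Continuous fun x : ℝ => ((x * besselJ 1 x : ℝ) : ℂ) - Complex.I *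
      ((-(2 / Real.pi) - 2 / Real.pi * (x ^ 2 / 4 * seriesSum (coeffY 1) (x ^ 2 / 4)) : ℝ) : ℂ) := by
    fun_prop
  have h2 := ((hc.tendsto 0).mono_left (nhdsWithin_le_nhds (s := Ioi (0 : ℝ)))).sub
    (((Complex.continuous_ofReal.tendsto 0).comp h1).const_mul (2 * Complex.I / (Real.pi : ℂ)))
  have he : ((0 * besselJ 1 0 : ℝ) : ℂ) - Complex.I *
      ((-(2 / Real.pi) - 2 / Real.pi * (0 ^ 2 / 4 * seriesSum (coeffY 1) (0 ^ 2 / 4)) : ℝ) : ℂ) -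
      2 * Complex.I / (Real.pi : ℂ) * ((0 : ℝ) : ℂ) = 2 * Complex.I / Real.pi := by
    simp
    ring
  rw [he] at h2
  refine h2.congr' ?_
  filter_upwards [self_mem_nhdsWithin] with x hx
  have h3 := congrArg (fun r : ℝ => (r : ℂ)) (besselY_one_eq hx)
  have h4 := congrArg (fun r : ℝ => (r : ℂ)) (besselJ_eq 1 x)
  simp only [Function.comp, hankel2]
  push_cast at h3 h4 ⊢
  linear_combination Complex.I * h3 + (2 * Complex.I / Real.pi * (Real.log (x / 2) : ℝ) * x) * h4

/-! ### The square root `√(v² + 2i)` -/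

/-- The principal square root of `v² + 2i`. -/
noncomputable def rootFn (v : ℝ) : ℂ := ((v : ℂ) ^ 2 + 2 * Complex.I) ^ ((2 : ℕ) : ℂ)⁻¹

theorem rootFn_sq (v : ℝ) : rootFn v ^ 2 = (v : ℂ) ^ 2 + 2 * Complex.I :=
  Complex.cpow_nat_inv_pow _ two_ne_zero

theorem im_sq_add (v : ℝ) : ((v : ℂ) ^ 2 + 2 * Complex.I).im = 2 := by
  simp [sq]

theorem sq_add_mem_slitPlane (v : ℝ) : (v : ℂ) ^ 2 + 2 * Complex.I ∈ Complex.slitPlane :=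
  Or.inr (by rw [im_sq_add]; norm_num)

theorem rootFn_re_mul_im (v : ℝ) : (rootFn v).re * (rootFn v).im = 1 := by
  have h := congrArg Complex.im (rootFn_sq v)
  rw [im_sq_add, sq, Complex.mul_im] at h
  linarith

theorem rootFn_re_sq (v : ℝ) : (rootFn v).re ^ 2 = v ^ 2 + (rootFn v).im ^ 2 := by
  have h := congrArg Complex.re (rootFn_sq v)
  simp only [sq, Complex.mul_re, Complex.add_re, Complex.ofReal_re, Complex.ofReal_im,
    Complex.I_re, Complex.I_im, Complex.re_ofNat, Complex.im_ofNat] at h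
  linarith

/-- The argument of the root is half of an argument in (-π, π), so its cosine is positive. -/
theorem rootFn_re_pos (v : ℝ) : 0 < (rootFn v).re := by
  have h0 : (v : ℂ) ^ 2 + 2 * Complex.I ≠ 0 := Complex.slitPlane_ne_zero (sq_add_mem_slitPlane v)
  have h1 : (Complex.log ((v : ℂ) ^ 2 + 2 * Complex.I) * ((2 : ℕ) : ℂ)⁻¹).im =
      ((v : ℂ) ^ 2 + 2 * Complex.I).arg / 2 := by
    rw [Nat.cast_ofNat, ← div_eq_mul_inv, Complex.div_ofNat_im, Complex.log_im]
  rw [rootFn, Complex.cpow_def_of_ne_zero h0, Complex.exp_re, h1]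
  refine mul_pos (Real.exp_pos _) (Real.cos_pos_of_mem_Ioo ⟨?_, ?_⟩)
  · linarith [Complex.neg_pi_lt_arg ((v : ℂ) ^ 2 + 2 * Complex.I)]
  · have := Complex.arg_le_pi ((v : ℂ) ^ 2 + 2 * Complex.I)
    have h3 := Complex.mem_slitPlane_iff_arg.1 (sq_add_mem_slitPlane v)
    have := lt_of_le_of_ne this h3.1
    linarith

/-- Real and imaginary parts have product 1, and the real part is the larger in modulus. All later
bounds on 1/`rootFn` come from here. -/
theorem one_le_rootFn_re (v : ℝ) : 1 ≤ (rootFn v).re := by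
  have h1 := rootFn_re_pos v
  have h2 := rootFn_re_mul_im v
  have h3 := rootFn_re_sq v
  by_contra! h
  have h4 : 1 < (rootFn v).im := by nlinarith
  nlinarith [sq_nonneg v]

theorem abs_lt_rootFn_re (v : ℝ) : |v| < (rootFn v).re := by
  refine abs_lt_of_sq_lt_sq ?_ (rootFn_re_pos v).le
  have h2 := rootFn_re_mul_im v
  have h3 := rootFn_re_sq v
  have h4 : (rootFn v).im ≠ 0 := fun h => by simp [h] at h2
  have := sq_pos_of_ne_zero h4
  linarith

theorem one_le_norm_rootFn (v : ℝ) : 1 ≤ ‖rootFn v‖ :=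
  (one_le_rootFn_re v).trans (Complex.re_le_norm _)

theorem rootFn_ne_zero (v : ℝ) : rootFn v ≠ 0 :=
  norm_pos_iff.1 (zero_lt_one.trans_le (one_le_norm_rootFn v))

theorem norm_rootFn_le (v : ℝ) : ‖rootFn v‖ ≤ 2 * (1 + v ^ 2) := by
  have h1 : ‖rootFn v‖ ^ 2 ≤ v ^ 2 + 2 := by
    rw [← norm_pow, rootFn_sq]
    refine (norm_add_le _ _).trans ?_
    simp
  have h2 := one_le_norm_rootFn v
  nlinarith

theorem hasDerivAt_rootFn (v : ℝ) : HasDerivAt rootFn (v / rootFn v) v := by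
  have h : HasDerivAt (fun z : ℂ => z ^ 2 + 2 * Complex.I) (2 * (v : ℂ)) (v : ℂ) := by
    simpa using (hasDerivAt_pow 2 (v : ℂ)).add_const (2 * Complex.I)
  have h2 := (h.cpow_const (c := ((2 : ℕ) : ℂ)⁻¹) (sq_add_mem_slitPlane v)).comp_ofReal
  refine h2.congr_deriv ?_
  rw [Complex.cpow_sub _ _ (Complex.slitPlane_ne_zero (sq_add_mem_slitPlane v)), Complex.cpow_one]
  have h3 := rootFn_sq v
  have h4 := rootFn_ne_zero v
  change ((2 : ℕ) : ℂ)⁻¹ * (rootFn v / ((v : ℂ) ^ 2 + 2 * Complex.I)) * (2 * v) = v / rootFn v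
  rw [← h3]
  push_cast
  field_simp

theorem continuous_rootFn : Continuous rootFn :=
  continuous_iff_continuousAt.2 fun v => (hasDerivAt_rootFn v).continuousAt

/-! ### Gaussian-type integrals on the half line -/

/-- Half of the Gaussian decay pays for the polynomial, by y^n / n! ≤ e^y with y = b(1 + v²)/2. -/
theorem one_add_sq_pow_mul_exp_le (n : ℕ) {b : ℝ} (hb : 0 < b) (v : ℝ) :
    (1 + v ^ 2) ^ n * Real.exp (-b * v ^ 2) ≤
      n.factorial * (2 / b) ^ n * Real.exp (b / 2) * Real.exp (-(b / 2) * v ^ 2) := by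
  have h := Real.pow_div_factorial_le_exp (b / 2 * (1 + v ^ 2)) (by positivity) n
  rw [div_le_iff₀ (by positivity), mul_pow] at h
  have h2 : (1 + v ^ 2) ^ n ≤ n.factorial * (2 / b) ^ n * Real.exp (b / 2 * (1 + v ^ 2)) := by
    calc (1 + v ^ 2) ^ n = (2 / b) ^ n * ((b / 2) ^ n * (1 + v ^ 2) ^ n) := by
          rw [← mul_assoc, ← mul_pow]
          simp [hb.ne']
      _ ≤ (2 / b) ^ n * (Real.exp (b / 2 * (1 + v ^ 2)) * n.factorial) := by gcongr
      _ = _ := by ring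
  calc (1 + v ^ 2) ^ n * Real.exp (-b * v ^ 2) ≤
      n.factorial * (2 / b) ^ n * Real.exp (b / 2 * (1 + v ^ 2)) * Real.exp (-b * v ^ 2) := by gcongr
    _ = _ := by
      rw [mul_assoc, mul_assoc _ (Real.exp (b / 2)), ← Real.exp_add, ← Real.exp_add]
      congr 2
      ring

theorem integrable_pow_mul_exp (n : ℕ) {b : ℝ} (hb : 0 < b) :
    Integrable fun v : ℝ => (1 + v ^ 2) ^ n * Real.exp (-b * v ^ 2) := by
  refine Integrable.mono' ((integrable_exp_neg_mul_sq (half_pos hb)).const_mul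
    (n.factorial * (2 / b) ^ n * Real.exp (b / 2))) (by fun_prop) (.of_forall fun v => ?_)
  rw [Real.norm_of_nonneg (by positivity)]
  exact one_add_sq_pow_mul_exp_le n hb v

theorem norm_kernel (x v : ℝ) :
    ‖Complex.exp (-x * ((v : ℂ) ^ 2 + Complex.I))‖ = Real.exp (-x * v ^ 2) := by
  rw [Complex.norm_exp]
  congr 1
  simp [sq]

/-- `∫_0^∞ q(v) e^{-x(v² + i)} dv`. -/
noncomputable def gaussTransform (q : ℝ → ℂ) (x : ℝ) : ℂ :=
  ∫ v in Ioi (0 : ℝ), q v * Complex.exp (-x * ((v : ℂ) ^ 2 + Complex.I))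

theorem integrableOn_gauss {q : ℝ → ℂ} (hq : Continuous q) {C : ℝ} {n : ℕ}
    (hb : ∀ v, 0 ≤ v → ‖q v‖ ≤ C * (1 + v ^ 2) ^ n) {x : ℝ} (hx : 0 < x) :
    IntegrableOn (fun v : ℝ => q v * Complex.exp (-x * ((v : ℂ) ^ 2 + Complex.I))) (Ioi 0) := by
  refine Integrable.mono' ((integrable_pow_mul_exp n hx).const_mul C).integrableOn
    (Continuous.aestronglyMeasurable (by fun_prop)) ?_
  filter_upwards [ae_restrict_mem measurableSet_Ioi] with v hv
  rw [norm_mul, norm_kernel, ← mul_assoc]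
  gcongr
  exact hb v (le_of_lt hv)

theorem hasDerivAt_gaussTransform {q : ℝ → ℂ} (hq : Continuous q) {C : ℝ} {n : ℕ}
    (hb : ∀ v, 0 ≤ v → ‖q v‖ ≤ C * (1 + v ^ 2) ^ n) {x : ℝ} (hx : 0 < x) :
    HasDerivAt (gaussTransform q)
      (gaussTransform (fun v => -((v : ℂ) ^ 2 + Complex.I) * q v) x) x := by
  have h := hasDerivAt_integral_of_dominated_loc_of_deriv_le (𝕜 := ℝ)
    (μ := volume.restrict (Ioi (0 : ℝ)))
    (F := fun (x : ℝ) (v : ℝ) => q v * Complex.exp (-x * ((v : ℂ) ^ 2 + Complex.I)))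
    (F' := fun (x : ℝ) (v : ℝ) =>
      -((v : ℂ) ^ 2 + Complex.I) * q v * Complex.exp (-x * ((v : ℂ) ^ 2 + Complex.I)))
    (x₀ := x) (s := Ioi (x / 2))
    (bound := fun v => C * ((1 + v ^ 2) ^ (n + 1) * Real.exp (-(x / 2) * v ^ 2)))
    (Ioi_mem_nhds (by linarith))
    (.of_forall fun y => Continuous.aestronglyMeasurable (by fun_prop))
    (integrableOn_gauss hq hb hx) (Continuous.aestronglyMeasurable (by fun_prop))
    ?_ ((integrable_pow_mul_exp (n + 1) (half_pos hx)).const_mul C).integrableOn ?_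
  · exact h.2
  · filter_upwards [ae_restrict_mem measurableSet_Ioi] with v hv y hy
    rw [norm_mul, norm_mul, norm_kernel, norm_neg]
    have h1 : ‖(v : ℂ) ^ 2 + Complex.I‖ ≤ 1 + v ^ 2 := by
      refine (norm_add_le _ _).trans ?_
      simp [add_comm]
    have h2 := hb v (le_of_lt hv)
    have h3 : Real.exp (-y * v ^ 2) ≤ Real.exp (-(x / 2) * v ^ 2) := by
      have : x / 2 < y := hy
      gcongr
    have hC : 0 ≤ C := by simpa using (norm_nonneg _).trans (hb 0 le_rfl)
    calc _ ≤ (1 + v ^ 2) * (C * (1 + v ^ 2) ^ n) * Real.exp (-(x / 2) * v ^ 2) := by gcongr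
      _ = _ := by ring
  · refine .of_forall fun v y _ => ?_
    have h1 : HasDerivAt (fun y : ℝ => -(y : ℂ) * ((v : ℂ) ^ 2 + Complex.I))
        (-1 * ((v : ℂ) ^ 2 + Complex.I)) y :=
      ((hasDerivAt_id y).ofReal_comp.neg).mul_const _
    refine (h1.cexp.const_mul (q v)).congr_deriv ?_
    ring

/-- Integral representation of `H_0`, up to the factor `2i/π`. -/
noncomputable def reprZero : ℝ → ℂ := gaussTransform fun v => 2 / rootFn v

/-- Integral representation of `H_1`, up to the factor `2i/π`. -/
noncomputable def reprOne : ℝ → ℂ :=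
  gaussTransform fun v => ((v : ℂ) ^ 2 + Complex.I) * (2 / rootFn v)

theorem continuous_two_div_rootFn : Continuous fun v => 2 / rootFn v :=
  continuous_const.div continuous_rootFn rootFn_ne_zero

theorem norm_two_div_rootFn_le (v : ℝ) : ‖2 / rootFn v‖ ≤ 2 := by
  rw [norm_div, Complex.norm_ofNat]
  exact div_le_self zero_le_two (one_le_norm_rootFn v)

theorem norm_sq_add_I_le (v : ℝ) : ‖(v : ℂ) ^ 2 + Complex.I‖ ≤ 1 + v ^ 2 := by
  refine (norm_add_le _ _).trans ?_
  simp [add_comm]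

theorem norm_reprOne_density_le (v : ℝ) :
    ‖((v : ℂ) ^ 2 + Complex.I) * (2 / rootFn v)‖ ≤ 2 * (1 + v ^ 2) ^ 1 := by
  rw [norm_mul, pow_one, mul_comm 2]
  gcongr
  · exact norm_sq_add_I_le v
  · exact norm_two_div_rootFn_le v

theorem hasDerivAt_reprZero {x : ℝ} (hx : 0 < x) : HasDerivAt reprZero (-reprOne x) x := by
  refine (hasDerivAt_gaussTransform continuous_two_div_rootFn (C := 2) (n := 0)
    (fun v _ => by simpa using norm_two_div_rootFn_le v) hx).congr_deriv ?_
  rw [reprOne, gaussTransform, gaussTransform, ← integral_neg]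
  congr 1
  funext v
  ring

theorem hasDerivAt_kernel (x v : ℝ) :
    HasDerivAt (fun v : ℝ => Complex.exp (-x * ((v : ℂ) ^ 2 + Complex.I)))
      (Complex.exp (-x * ((v : ℂ) ^ 2 + Complex.I)) * (-2 * x * v)) v := by
  have h1 : HasDerivAt (fun z : ℂ => -(x : ℂ) * (z ^ 2 + Complex.I)) (-2 * x * v) (v : ℂ) := by
    have := ((hasDerivAt_pow 2 (v : ℂ)).add_const Complex.I).const_mul (-(x : ℂ))
    refine this.congr_deriv ?_
    push_cast
    ring
  exact h1.cexp.comp_ofReal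

/-- Integration by parts against the kernel. The boundary term at infinity vanishes because an
integrable function with integrable derivative tends to zero. -/
theorem integral_gauss_of_hasDerivAt {p p' : ℝ → ℂ} (hp : Continuous p) (hp' : Continuous p')
    (hd : ∀ v, 0 ≤ v → HasDerivAt p (p' v) v) {C : ℝ} {n : ℕ}
    (hb : ∀ v, 0 ≤ v → ‖p v‖ ≤ C * (1 + v ^ 2) ^ n)
    (hb' : ∀ v, 0 ≤ v → ‖p' v‖ ≤ C * (1 + v ^ 2) ^ n) {x : ℝ} (hx : 0 < x) :
    gaussTransform p' x =
      2 * x * gaussTransform (fun v => v * p v) x - p 0 * Complex.exp (-x * Complex.I) := by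
  have hC : 0 ≤ C := by simpa using (norm_nonneg _).trans (hb 0 le_rfl)
  have hbv : ∀ v : ℝ, 0 ≤ v → ‖(v : ℂ) * p v‖ ≤ C * (1 + v ^ 2) ^ (n + 1) := fun v hv => by
    rw [norm_mul, Complex.norm_real, Real.norm_of_nonneg hv]
    calc v * ‖p v‖ ≤ (1 + v ^ 2) * (C * (1 + v ^ 2) ^ n) := by
          gcongr
          · nlinarith [sq_nonneg (v - 1)]
          · exact hb v hv
      _ = _ := by ring
  have hi1 := integrableOn_gauss hp hb hx
  have hi2 := integrableOn_gauss hp' hb' hx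
  have hi3 := integrableOn_gauss (q := fun v => v * p v) (by fun_prop) hbv hx
  have hd2 : ∀ v ∈ Ici (0 : ℝ), HasDerivAt
      (fun v : ℝ => p v * Complex.exp (-x * ((v : ℂ) ^ 2 + Complex.I)))
      (p' v * Complex.exp (-x * ((v : ℂ) ^ 2 + Complex.I)) -
        2 * x * (v * p v * Complex.exp (-x * ((v : ℂ) ^ 2 + Complex.I)))) v := fun v hv => by
    refine ((hd v hv).mul (hasDerivAt_kernel x v)).congr_deriv ?_
    ring
  have hi4 := hi2.sub (hi3.const_mul (2 * x : ℂ))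
  have ht := tendsto_zero_of_hasDerivAt_of_integrableOn_Ioi
    (fun v hv => hd2 v (Ioi_subset_Ici_self hv)) hi4 hi1
  have h := integral_Ioi_of_hasDerivAt_of_tendsto' hd2 hi4 ht
  rw [integral_sub hi2 (hi3.const_mul (2 * x : ℂ)), integral_const_mul] at h
  rw [gaussTransform, gaussTransform, sub_eq_iff_eq_add.1 h]
  simp
  ring

/-- Write w for `rootFn v`. From w² = v² + 2i one gets (v² + i)² = v² w² - 1, so the differentiated
density is 2/w - 2v²w. Since (v w)' = 2(v² + i)/w is the density of `reprOne`, integration by parts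
identifies the transform of 2v²w with `reprOne x / x`. -/
theorem hasDerivAt_reprOne {x : ℝ} (hx : 0 < x) :
    HasDerivAt reprOne (reprZero x - reprOne x / x) x := by
  have hc := continuous_two_div_rootFn
  have hw := continuous_rootFn
  refine (hasDerivAt_gaussTransform (by fun_prop) (C := 2) (n := 1)
    (fun v _ => norm_reprOne_density_le v) hx).congr_deriv ?_
  have hib := integral_gauss_of_hasDerivAt (p := fun v => v * rootFn v)
    (p' := fun v => ((v : ℂ) ^ 2 + Complex.I) * (2 / rootFn v)) (C := 2) (n := 2)
    (by fun_prop) (by fun_prop) (fun v _ => ?_) (fun v hv => ?_) (fun v _ => ?_) hx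
  · have h1 : gaussTransform (fun v => -((v : ℂ) ^ 2 + Complex.I) *
        (((v : ℂ) ^ 2 + Complex.I) * (2 / rootFn v))) x =
        reprZero x - 2 * gaussTransform (fun v => v * (v * rootFn v)) x := by
      rw [reprZero, gaussTransform, gaussTransform, gaussTransform, ← integral_const_mul,
        ← integral_sub]
      · congr 1
        funext v
        have h3 := rootFn_sq v
        have h4 := rootFn_ne_zero v
        have h5 : -((v : ℂ) ^ 2 + Complex.I) * (((v : ℂ) ^ 2 + Complex.I) * (2 / rootFn v)) =
            2 / rootFn v - 2 * (v * (v * rootFn v)) := by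
          field_simp
          linear_combination (v : ℂ) ^ 2 * h3 - Complex.I_sq
        rw [h5]
        ring
      · exact integrableOn_gauss hc (C := 2) (n := 0)
          (fun v _ => by simpa using norm_two_div_rootFn_le v) hx
      · refine (integrableOn_gauss (by fun_prop) (C := 2) (n := 2) (fun v _ => ?_) hx).const_mul 2
        rw [← mul_assoc, norm_mul, ← Complex.ofReal_mul, Complex.norm_real,
          Real.norm_of_nonneg (mul_self_nonneg v)]
        have := norm_rootFn_le v
        nlinarith [sq_nonneg v, norm_nonneg (rootFn v)]
    rw [h1]
    have h2 : reprOne x = 2 * x * gaussTransform (fun v => v * (v * rootFn v)) x := by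
      rw [reprOne, hib]
      simp
    have hx' : (x : ℂ) ≠ 0 := by exact_mod_cast hx.ne'
    rw [h2]
    field_simp
  · refine ((hasDerivAt_id v).ofReal_comp.mul (hasDerivAt_rootFn v)).congr_deriv ?_
    have h3 := rootFn_sq v
    have h4 := rootFn_ne_zero v
    simp only [id, Complex.ofReal_one]
    field_simp
    linear_combination h3
  · rw [norm_mul, Complex.norm_real, Real.norm_of_nonneg hv]
    have := norm_rootFn_le v
    calc v * ‖rootFn v‖ ≤ (1 + v ^ 2) * (2 * (1 + v ^ 2)) := by
          gcongr
          nlinarith [sq_nonneg (v - 1)]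
      _ = _ := by ring
  · refine (norm_reprOne_density_le v).trans ?_
    gcongr
    · nlinarith [sq_nonneg v]
    · norm_num

/-! ### Uniqueness for the Bessel system -/

/-- The energy |f|² + |g|² decreases in x, so it suffices that it is small near 0. Only x g → 0 is
assumed there, so smallness is first extracted from x² times the energy, whose derivative 2x|f|² no
longer contains g. -/
theorem bessel_system_unique {f g : ℝ → ℂ} (hf : ∀ x, 0 < x → HasDerivAt f (-g x) x)
    (hg : ∀ x, 0 < x → HasDerivAt g (f x - g x / x) x) (hf0 : Tendsto f (𝓝[>] 0) (𝓝 0))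
    (hg0 : Tendsto (fun x : ℝ => (x : ℂ) * g x) (𝓝[>] 0) (𝓝 0)) {x : ℝ} (hx : 0 < x) :
    f x = 0 ∧ g x = 0 := by
  set e : ℝ → ℝ := fun x => ‖f x‖ ^ 2 + ‖g x‖ ^ 2
  have he : ∀ x, 0 < x → HasDerivAt e (-2 * ‖g x‖ ^ 2 / x) x := fun x hx => by
    refine ((hf x hx).norm_sq.add (hg x hx).norm_sq).congr_deriv ?_
    have h1 : g x / x = (1 / x : ℝ) • g x := by
      rw [Complex.real_smul]
      push_cast
      ring
    rw [inner_neg_right, inner_sub_right, h1, real_inner_smul_right, real_inner_self_eq_norm_sq,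
      real_inner_comm]
    ring
  have hanti : AntitoneOn e (Ioi 0) := by
    refine antitoneOn_of_deriv_nonpos (convex_Ioi 0)
      (fun x hx => (he x hx).continuousAt.continuousWithinAt) ?_ ?_
    · rw [interior_Ioi]
      exact fun x hx => (he x hx).differentiableAt.differentiableWithinAt
    · rw [interior_Ioi]
      intro x hx
      rw [(he x hx).deriv]
      have : 0 < x := hx
      refine div_nonpos_of_nonpos_of_nonneg ?_ this.le
      nlinarith [sq_nonneg ‖g x‖]
  have hlim : Tendsto (fun x => x ^ 2 * e x) (𝓝[>] 0) (𝓝 0) := by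
    have h1 : Tendsto (fun x : ℝ => x) (𝓝[>] 0) (𝓝 0) := tendsto_id.mono_left nhdsWithin_le_nhds
    have h2 := ((h1.mul hf0.norm).pow 2).add (hg0.norm.pow 2)
    simp only [norm_zero, mul_zero, ne_eq, OfNat.ofNat_ne_zero, not_false_eq_true, zero_pow,
      add_zero] at h2
    refine h2.congr fun x => ?_
    simp only [e, norm_mul, Complex.norm_real, Real.norm_eq_abs, mul_pow, sq_abs]
    ring
  have hsmall : ∀ η : ℝ, 0 < η → e x ≤ η := fun η hη => by
    have h1 : ∀ᶠ y in 𝓝[>] (0 : ℝ), ‖f y‖ ^ 2 < η := by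
      have := hf0.norm.pow 2
      simp only [norm_zero, ne_eq, OfNat.ofNat_ne_zero, not_false_eq_true, zero_pow] at this
      exact this.eventually_lt_const hη
    obtain ⟨δ, hδ, hδf⟩ := mem_nhdsGT_iff_exists_Ioo_subset.1 h1
    have hδ' : 0 < δ := hδ
    -- Where |f|² < η this function decreases, and it starts from the limit 0; hence it is
    -- nonpositive and the energy is at most η.
    have hG : ∀ y, 0 < y → HasDerivAt (fun y => y ^ 2 * e y - η * y ^ 2)
        (2 * y * (‖f y‖ ^ 2 - η)) y := fun y hy => by
      refine (((hasDerivAt_pow 2 y).mul (he y hy)).sub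
        ((hasDerivAt_pow 2 y).const_mul η)).congr_deriv ?_
      simp only [e]
      field_simp
      push_cast
      ring
    have hGanti : AntitoneOn (fun y => y ^ 2 * e y - η * y ^ 2) (Ioo 0 δ) := by
      refine antitoneOn_of_deriv_nonpos (convex_Ioo 0 δ)
        (fun y hy => (hG y hy.1).continuousAt.continuousWithinAt) ?_ ?_
      · rw [interior_Ioo]
        exact fun y hy => (hG y hy.1).differentiableAt.differentiableWithinAt
      · rw [interior_Ioo]
        intro y hy
        rw [(hG y hy.1).deriv]
        have h2 : ‖f y‖ ^ 2 < η := hδf hy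
        have := hy.1
        nlinarith
    have hGlim : Tendsto (fun y => y ^ 2 * e y - η * y ^ 2) (𝓝[>] 0) (𝓝 0) := by
      have h3 : Tendsto (fun y : ℝ => η * y ^ 2) (𝓝[>] 0) (𝓝 0) := by
        have : Tendsto (fun y : ℝ => η * y ^ 2) (𝓝 0) (𝓝 (η * 0 ^ 2)) :=
          Continuous.tendsto (by fun_prop) 0
        simp only [ne_eq, OfNat.ofNat_ne_zero, not_false_eq_true, zero_pow, mul_zero] at this
        exact this.mono_left nhdsWithin_le_nhds
      simpa using hlim.sub h3
    have hnear : ∀ y ∈ Ioo 0 δ, e y ≤ η := fun y hy => by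
      have h4 : y ^ 2 * e y - η * y ^ 2 ≤ 0 := by
        refine ge_of_tendsto hGlim ?_
        filter_upwards [Ioo_mem_nhdsGT hy.1] with z hz
        exact hGanti ⟨hz.1, hz.2.trans hy.2⟩ hy hz.2.le
      have : 0 < y ^ 2 := pow_pos hy.1 2
      nlinarith
    set y := min x (δ / 2)
    have hy0 : 0 < y := lt_min hx (by positivity)
    exact (hanti hy0 hx (min_le_left _ _)).trans
      (hnear y ⟨hy0, (min_le_right _ _).trans_lt (by linarith)⟩)
  have h0 : e x ≤ 0 := le_of_forall_pos_le_add fun η hη => by simpa using hsmall η hη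
  have hf' : ‖f x‖ ^ 2 = 0 := by
    have : ‖f x‖ ^ 2 + ‖g x‖ ^ 2 ≤ 0 := h0
    nlinarith [sq_nonneg ‖f x‖, sq_nonneg ‖g x‖]
  have hg' : ‖g x‖ ^ 2 = 0 := by
    have : ‖f x‖ ^ 2 + ‖g x‖ ^ 2 ≤ 0 := h0
    nlinarith [sq_nonneg ‖f x‖, sq_nonneg ‖g x‖]
  exact ⟨by simpa using hf', by simpa using hg'⟩

/-! ### Moments -/

theorem kernel_eq (x v : ℝ) : Complex.exp (-x * ((v : ℂ) ^ 2 + Complex.I)) =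
    Complex.exp (-x * Complex.I) * (Real.exp (-x * v ^ 2) : ℝ) := by
  rw [Complex.ofReal_exp, ← Complex.exp_add]
  congr 1
  push_cast
  ring

theorem norm_exp_neg_mul_I (x : ℝ) : ‖Complex.exp (-x * Complex.I)‖ = 1 := by
  rw [← Complex.ofReal_neg, Complex.norm_exp_ofReal_mul_I]

theorem gaussTransform_eq (q : ℝ → ℂ) (x : ℝ) : gaussTransform q x =
    Complex.exp (-x * Complex.I) * ∫ v in Ioi (0 : ℝ), q v * (Real.exp (-x * v ^ 2) : ℝ) := by
  rw [gaussTransform, ← integral_const_mul]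
  congr 1
  funext v
  rw [kernel_eq]
  ring

theorem gaussTransform_const (a : ℂ) (x : ℝ) : gaussTransform (fun _ => a) x =
    Complex.exp (-x * Complex.I) * (a * (√(Real.pi / x) / 2 : ℝ)) := by
  rw [gaussTransform_eq, integral_const_mul, integral_complex_ofReal, integral_gaussian_Ioi]

theorem integral_sq_mul_gaussian {x : ℝ} (hx : 0 < x) :
    ∫ v in Ioi (0 : ℝ), v ^ 2 * Real.exp (-x * v ^ 2) = √(Real.pi / x) / (4 * x) := by
  have h := integral_gauss_of_hasDerivAt (p := fun v => (v : ℂ)) (p' := fun _ => 1) (C := 1) (n := 1)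
    (by fun_prop) (by fun_prop) (fun v _ => (hasDerivAt_id v).ofReal_comp) (fun v hv => ?_)
    (fun v _ => by simpa using sq_nonneg v) hx
  · rw [gaussTransform_const, gaussTransform_eq] at h
    have h1 : ∀ v : ℝ, (v : ℂ) * v * (Real.exp (-x * v ^ 2) : ℝ) =
        ((v ^ 2 * Real.exp (-x * v ^ 2) : ℝ) : ℂ) := fun v => by push_cast; ring
    simp only [h1, integral_complex_ofReal] at h
    have h2 : Complex.exp (-x * Complex.I) ≠ 0 := Complex.exp_ne_zero _
    have h3 : ((√(Real.pi / x) / 2 : ℝ) : ℂ) =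
        ((2 * x * ∫ v in Ioi (0 : ℝ), v ^ 2 * Real.exp (-x * v ^ 2) : ℝ) : ℂ) := by
      refine mul_left_cancel₀ h2 ?_
      push_cast at h ⊢
      linear_combination h
    have h4 := Complex.ofReal_injective h3
    rw [eq_div_iff (by positivity)]
    linear_combination (-2) * h4
  · rw [Complex.norm_real, Real.norm_of_nonneg hv]
    nlinarith [sq_nonneg (v - 1)]

theorem norm_gaussTransform_le {q : ℝ → ℂ} {B C x : ℝ} (hx : 0 < x)
    (hb : ∀ v, 0 ≤ v → ‖q v‖ ≤ B + C * v ^ 2) :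
    ‖gaussTransform q x‖ ≤ √(Real.pi / x) * (B / 2 + C / (4 * x)) := by
  have hi0 : IntegrableOn (fun v : ℝ => Real.exp (-x * v ^ 2)) (Ioi 0) :=
    (integrable_exp_neg_mul_sq hx).integrableOn
  have hi2 : IntegrableOn (fun v : ℝ => v ^ 2 * Real.exp (-x * v ^ 2)) (Ioi 0) := by
    refine (Integrable.mono' (integrable_pow_mul_exp 1 hx) (by fun_prop)
      (.of_forall fun v => ?_)).integrableOn
    rw [Real.norm_of_nonneg (by positivity), pow_one]
    gcongr
    linarith
  have h : ‖gaussTransform q x‖ ≤ ∫ v in Ioi (0 : ℝ),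
      (B * Real.exp (-x * v ^ 2) + C * (v ^ 2 * Real.exp (-x * v ^ 2))) := by
    refine norm_integral_le_of_norm_le ((hi0.const_mul B).add (hi2.const_mul C)) ?_
    filter_upwards [ae_restrict_mem measurableSet_Ioi] with v hv
    rw [norm_mul, norm_kernel, ← mul_assoc, ← add_mul]
    gcongr
    exact hb v (le_of_lt hv)
  rw [integral_add (hi0.const_mul B) (hi2.const_mul C), integral_const_mul, integral_const_mul,
    integral_sq_mul_gaussian hx, integral_gaussian_Ioi] at h
  refine h.trans (le_of_eq ?_)
  ring

theorem gaussTransform_sub {q r : ℝ → ℂ} {x : ℝ}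
    (hq : IntegrableOn (fun v : ℝ => q v * Complex.exp (-x * ((v : ℂ) ^ 2 + Complex.I))) (Ioi 0))
    (hr : IntegrableOn (fun v : ℝ => r v * Complex.exp (-x * ((v : ℂ) ^ 2 + Complex.I))) (Ioi 0)) :
    gaussTransform q x - gaussTransform r x = gaussTransform (fun v => q v - r v) x := by
  rw [gaussTransform, gaussTransform, gaussTransform, ← integral_sub hq hr]
  congr 1
  funext v
  ring

theorem integrableOn_reprZero {x : ℝ} (hx : 0 < x) : IntegrableOn (fun v : ℝ =>
    2 / rootFn v * Complex.exp (-x * ((v : ℂ) ^ 2 + Complex.I))) (Ioi 0) :=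
  integrableOn_gauss continuous_two_div_rootFn (C := 2) (n := 0)
    (fun v _ => by simpa using norm_two_div_rootFn_le v) hx

theorem integrableOn_reprOne {x : ℝ} (hx : 0 < x) : IntegrableOn (fun v : ℝ =>
    ((v : ℂ) ^ 2 + Complex.I) * (2 / rootFn v) *
      Complex.exp (-x * ((v : ℂ) ^ 2 + Complex.I))) (Ioi 0) := by
  have := continuous_two_div_rootFn
  exact integrableOn_gauss (q := fun v => ((v : ℂ) ^ 2 + Complex.I) * (2 / rootFn v))
    (by fun_prop) (fun v _ => norm_reprOne_density_le v) hx

theorem integrableOn_const_gauss (a : ℂ) {x : ℝ} (hx : 0 < x) : IntegrableOn (fun v : ℝ =>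
    a * Complex.exp (-x * ((v : ℂ) ^ 2 + Complex.I))) (Ioi 0) :=
  integrableOn_gauss (q := fun _ => a) (by fun_prop) (C := ‖a‖) (n := 0) (fun v _ => by simp) hx

/-! ### Behaviour for large arguments -/

/-- Rationalise the difference of the two roots: their squares differ by v², and the factors of the
denominator have moduli at least 1, 1 and 2. -/
theorem norm_two_div_rootFn_sub_le (v : ℝ) : ‖2 / rootFn v - 2 / rootFn 0‖ ≤ v ^ 2 := by
  have h1 := rootFn_ne_zero v
  have h2 := rootFn_ne_zero 0
  have h5 : 2 ≤ ‖rootFn v + rootFn 0‖ := by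
    refine le_trans ?_ (Complex.re_le_norm _)
    rw [Complex.add_re]
    linarith [one_le_rootFn_re v, one_le_rootFn_re 0]
  have h6 : rootFn v + rootFn 0 ≠ 0 := norm_pos_iff.1 (by linarith)
  have h7 : 2 / rootFn v - 2 / rootFn 0 =
      -(2 * (v : ℂ) ^ 2) / (rootFn v * rootFn 0 * (rootFn v + rootFn 0)) := by
    have h3 := rootFn_sq v
    have h4 := rootFn_sq 0
    rw [Complex.ofReal_zero] at h4
    field_simp
    linear_combination h4 - h3
  rw [h7, norm_div, norm_neg, norm_mul, norm_mul, norm_mul, norm_pow, Complex.norm_ofNat,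
    Complex.norm_real, Real.norm_eq_abs, sq_abs, div_le_iff₀ (by positivity)]
  have h8 := one_le_norm_rootFn v
  have h9 := one_le_norm_rootFn 0
  have h10 : 1 * 1 * 2 ≤ ‖rootFn v‖ * ‖rootFn 0‖ * ‖rootFn v + rootFn 0‖ := by gcongr
  nlinarith [sq_nonneg v]

/-- Laplace's method: the density is frozen at v = 0, and the error O(v²) costs a factor 1/x through
the second Gaussian moment. -/
theorem norm_reprZero_sub_le {x : ℝ} (hx : 0 < x) :
    ‖reprZero x - Complex.exp (-x * Complex.I) * (√(Real.pi / x) / rootFn 0)‖ ≤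
      √(Real.pi / x) * (1 / (4 * x)) := by
  have h1 : Complex.exp (-x * Complex.I) * (√(Real.pi / x) / rootFn 0) =
      gaussTransform (fun _ => 2 / rootFn 0) x := by
    rw [gaussTransform_const]
    push_cast
    ring
  rw [h1, reprZero, gaussTransform_sub (integrableOn_reprZero hx) (integrableOn_const_gauss _ hx)]
  refine (norm_gaussTransform_le (B := 0) (C := 1) hx fun v _ => ?_).trans (le_of_eq (by ring))
  simpa using norm_two_div_rootFn_sub_le v

theorem norm_reprZero_le {x : ℝ} (hx : 0 < x) : ‖reprZero x‖ ≤ √(Real.pi / x) := by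
  refine (norm_gaussTransform_le (B := 2) (C := 0) hx fun v _ => ?_).trans (le_of_eq (by ring))
  simpa using norm_two_div_rootFn_le v

theorem norm_reprOne_sub_le {x : ℝ} (hx : 0 < x) :
    ‖reprOne x - Complex.exp (-x * Complex.I) * (Complex.I * √(Real.pi / x) / rootFn 0)‖ ≤
      √(Real.pi / x) * (3 / (4 * x)) := by
  have h1 : Complex.exp (-x * Complex.I) * (Complex.I * √(Real.pi / x) / rootFn 0) =
      gaussTransform (fun _ => Complex.I * (2 / rootFn 0)) x := by
    rw [gaussTransform_const]
    push_cast
    ring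
  rw [h1, reprOne, gaussTransform_sub (integrableOn_reprOne hx) (integrableOn_const_gauss _ hx)]
  -- The constant 3 is 2, from v² times the bounded factor 2/`rootFn v`, plus 1 from the variation
  -- of that factor.
  refine (norm_gaussTransform_le (B := 0) (C := 3) hx fun v _ => ?_).trans (le_of_eq (by ring))
  have h2 : ((v : ℂ) ^ 2 + Complex.I) * (2 / rootFn v) - Complex.I * (2 / rootFn 0) =
      (v : ℂ) ^ 2 * (2 / rootFn v) + Complex.I * (2 / rootFn v - 2 / rootFn 0) := by ring
  rw [h2]
  refine (norm_add_le _ _).trans ?_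
  rw [norm_mul, norm_mul, Complex.norm_I, norm_pow, Complex.norm_real, Real.norm_eq_abs, sq_abs]
  nlinarith [norm_two_div_rootFn_sub_le v, norm_two_div_rootFn_le v, sq_nonneg v]

/-! ### Behaviour at the origin -/

/-- For x → 0 large v dominate, where the density behaves like 2v, whose transform is exactly
e^{-ix}/x. The bounded remainder contributes only O(x^{-1/2}). -/
theorem norm_reprOne_density_sub_le {v : ℝ} (hv : 0 ≤ v) :
    ‖((v : ℂ) ^ 2 + Complex.I) * (2 / rootFn v) - 2 * v‖ ≤ 6 := by
  have h1 := rootFn_ne_zero v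
  have h3 := rootFn_sq v
  have h5 : v ≤ ‖rootFn v + v‖ ∧ 1 ≤ ‖rootFn v + v‖ := by
    have := Complex.re_le_norm (rootFn v + v)
    rw [Complex.add_re, Complex.ofReal_re] at this
    have := one_le_rootFn_re v
    constructor <;> linarith
  have h6 : rootFn v + v ≠ 0 := norm_pos_iff.1 (by linarith)
  have h7 : ((v : ℂ) ^ 2 + Complex.I) * (2 / rootFn v) - 2 * v =
      2 / rootFn v * (Complex.I - 2 * Complex.I * (v / (rootFn v + v))) := by
    field_simp
    linear_combination (-v : ℂ) * h3
  have h8 : ‖(v : ℂ) / (rootFn v + v)‖ ≤ 1 := by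
    rw [norm_div, Complex.norm_real, Real.norm_of_nonneg hv, div_le_one (by linarith)]
    exact h5.1
  have h9 : ‖Complex.I - 2 * Complex.I * (v / (rootFn v + v))‖ ≤ 3 := by
    refine (norm_sub_le _ _).trans ?_
    rw [norm_mul, norm_mul, Complex.norm_I, Complex.norm_ofNat]
    linarith
  rw [h7, norm_mul]
  have := norm_two_div_rootFn_le v
  nlinarith [norm_nonneg (2 / rootFn v),
    norm_nonneg (Complex.I - 2 * Complex.I * (v / (rootFn v + v)))]

theorem norm_reprOne_sub_inv_le {x : ℝ} (hx : 0 < x) :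
    ‖reprOne x - Complex.exp (-x * Complex.I) / x‖ ≤ √(Real.pi / x) * 3 := by
  have hi : IntegrableOn (fun v : ℝ =>
      2 * (v : ℂ) * Complex.exp (-x * ((v : ℂ) ^ 2 + Complex.I))) (Ioi 0) := by
    refine integrableOn_gauss (q := fun v => 2 * (v : ℂ)) (by fun_prop) (C := 1) (n := 1)
      (fun v hv => ?_) hx
    rw [norm_mul, Complex.norm_ofNat, Complex.norm_real, Real.norm_of_nonneg hv]
    nlinarith [sq_nonneg (v - 1)]
  have h1 : Complex.exp (-x * Complex.I) / x = gaussTransform (fun v => 2 * v) x := by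
    have h := integral_gauss_of_hasDerivAt (p := fun _ => 2) (p' := fun _ => 0) (C := 2) (n := 0)
      (by fun_prop) (by fun_prop) (fun v _ => hasDerivAt_const v _) (fun v hv => by simp)
      (fun v _ => by simp) hx
    have h0 : gaussTransform (fun _ => 0) x = 0 := by simp [gaussTransform]
    have hx' : (x : ℂ) ≠ 0 := by exact_mod_cast hx.ne'
    simp only [mul_comm _ (2 : ℂ)] at h ⊢
    rw [h0] at h
    rw [div_eq_iff hx']
    linear_combination (1 / 2 : ℂ) * h
  rw [h1, reprOne, gaussTransform_sub (integrableOn_reprOne hx) hi]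
  refine (norm_gaussTransform_le (B := 6) (C := 0) hx fun v hv => ?_).trans (le_of_eq (by ring))
  simpa using norm_reprOne_density_sub_le hv

theorem tendsto_mul_sqrt_pi_div : Tendsto (fun x : ℝ => x * √(Real.pi / x)) (𝓝[>] 0) (𝓝 0) := by
  have h : Tendsto (fun x : ℝ => √(Real.pi * x)) (𝓝 0) (𝓝 (√(Real.pi * 0))) :=
    Continuous.tendsto (by fun_prop) 0
  rw [mul_zero, Real.sqrt_zero] at h
  refine (h.mono_left nhdsWithin_le_nhds).congr' ?_
  filter_upwards [self_mem_nhdsWithin] with x hx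
  have hx' : 0 < x := hx
  rw [show Real.pi * x = x ^ 2 * (Real.pi / x) by field_simp, Real.sqrt_mul (by positivity),
    Real.sqrt_sq hx'.le]

theorem tendsto_mul_reprOne : Tendsto (fun x : ℝ => (x : ℂ) * reprOne x) (𝓝[>] 0) (𝓝 1) := by
  have h1 : Tendsto (fun x : ℝ => Complex.exp (-x * Complex.I)) (𝓝[>] 0) (𝓝 1) := by
    have : Tendsto (fun x : ℝ => Complex.exp (-x * Complex.I)) (𝓝 0)
      (𝓝 (Complex.exp (-(0 : ℝ) * Complex.I))) := Continuous.tendsto (by fun_prop) 0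
    rw [Complex.ofReal_zero, neg_zero, zero_mul, Complex.exp_zero] at this
    exact this.mono_left nhdsWithin_le_nhds
  have h2 : Tendsto (fun x : ℝ => (x : ℂ) * reprOne x - Complex.exp (-x * Complex.I))
      (𝓝[>] 0) (𝓝 0) := by
    refine squeeze_zero_norm' ?_ (by simpa using tendsto_mul_sqrt_pi_div.mul_const 3)
    filter_upwards [self_mem_nhdsWithin] with x hx
    have hx0 : 0 < x := hx
    have hx' : (x : ℂ) ≠ 0 := by exact_mod_cast hx0.ne'
    have h3 : (x : ℂ) * reprOne x - Complex.exp (-x * Complex.I) =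
        x * (reprOne x - Complex.exp (-x * Complex.I) / x) := by field_simp
    rw [h3, norm_mul, Complex.norm_real, Real.norm_of_nonneg hx0.le, mul_assoc]
    gcongr
    exact norm_reprOne_sub_inv_le hx0
  simpa using h2.add h1

/-- This is Γ'(1) = -γ, with Euler's integral differentiated under the integral sign. -/
theorem integral_log_mul_exp_neg_complex :
    ∫ t in Ioi (0 : ℝ), ((Real.log t * Real.exp (-t) : ℝ) : ℂ) = -Real.eulerMascheroniConstant := by
  have h1 := Complex.hasDerivAt_GammaIntegral (s := 1) (by simp)
  have h2 : Complex.GammaIntegral =ᶠ[𝓝 1] Complex.Gamma := by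
    have : IsOpen {s : ℂ | 0 < s.re} := Complex.continuous_re.isOpen_preimage _ isOpen_Ioi
    filter_upwards [this.mem_nhds (by simp : (1 : ℂ) ∈ {s : ℂ | 0 < s.re})] with s hs
    exact (Complex.Gamma_eq_integral hs).symm
  rw [(Complex.hasDerivAt_Gamma_one.congr_of_eventuallyEq h2).unique h1]
  congr 1
  funext t
  simp

theorem integral_log_mul_exp_neg :
    ∫ t in Ioi (0 : ℝ), Real.log t * Real.exp (-t) = -Real.eulerMascheroniConstant := by
  have h := integral_log_mul_exp_neg_complex
  rw [integral_complex_ofReal] at h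
  exact_mod_cast h

theorem integrableOn_log_mul_exp_neg :
    IntegrableOn (fun t : ℝ => Real.log t * Real.exp (-t)) (Ioi 0) := by
  -- A non-integrable function has Bochner integral 0 by convention, so a nonzero value proves
  -- integrability.
  refine Integrable.of_integral_ne_zero ?_
  rw [integral_log_mul_exp_neg]
  linarith [Real.one_half_lt_eulerMascheroniConstant]

/-- Substitute u = x v²: then 4xv dv = 2 du and 2 log(2v) = 2 log 2 - log x + log u. -/
theorem log_gaussian {x : ℝ} (hx : 0 < x) :
    IntegrableOn (fun v : ℝ => 4 * x * v * Real.log (2 * v) * Real.exp (-x * v ^ 2)) (Ioi 0) ∧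
    ∫ v in Ioi (0 : ℝ), 4 * x * v * Real.log (2 * v) * Real.exp (-x * v ^ 2) =
      2 * Real.log 2 - Real.eulerMascheroniConstant - Real.log x := by
  set a := 2 * Real.log 2 - Real.log x
  set g : ℝ → ℝ := fun u => a * Real.exp (-u) + Real.log u * Real.exp (-u)
  have hi : IntegrableOn g (Ioi 0) :=
    ((integrableOn_exp_neg_Ioi 0).const_mul a).add integrableOn_log_mul_exp_neg
  have hg : ∫ u in Ioi (0 : ℝ), g u =
      2 * Real.log 2 - Real.eulerMascheroniConstant - Real.log x := by
    rw [integral_add ((integrableOn_exp_neg_Ioi 0).const_mul a) integrableOn_log_mul_exp_neg,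
      integral_const_mul, integral_exp_neg_Ioi, integral_log_mul_exp_neg]
    simp [a]
    ring
  have hi2 : IntegrableOn (fun u => g (x * u)) (Ioi 0) := by
    rw [integrableOn_Ioi_comp_mul_left_iff _ _ hx, mul_zero]
    exact hi
  have hi3 := (integrableOn_Ioi_comp_rpow_iff' (fun u => g (x * u)) two_ne_zero).2 hi2
  have he : EqOn (fun v : ℝ => 2 * x * (v ^ ((2 : ℝ) - 1) • g (x * v ^ (2 : ℝ))))
      (fun v : ℝ => 4 * x * v * Real.log (2 * v) * Real.exp (-x * v ^ 2)) (Ioi 0) := by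
    intro v hv
    have hv' : 0 < v := hv
    have h1 : v ^ ((2 : ℝ) - 1) = v := by norm_num
    have h2 : v ^ (2 : ℝ) = v ^ 2 := by norm_cast
    simp only [h1, h2, g, a, smul_eq_mul]
    rw [Real.log_mul hx.ne' (by positivity), Real.log_pow, Real.log_mul two_ne_zero hv'.ne',
      neg_mul]
    push_cast
    ring
  refine ⟨(integrableOn_congr_fun he measurableSet_Ioi).1 (hi3.const_mul (2 * x)), ?_⟩
  rw [← setIntegral_congr_fun measurableSet_Ioi he, integral_const_mul, ← hg]
  have h4 := integral_comp_rpow_Ioi_of_pos (g := fun u => g (x * u)) (p := 2) two_pos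
  rw [integral_comp_mul_left_Ioi g 0 hx, mul_zero, smul_eq_mul] at h4
  have h5 : ∀ v : ℝ, ((2 : ℝ) * v ^ ((2 : ℝ) - 1)) • g (x * v ^ (2 : ℝ)) =
      2 * (v ^ ((2 : ℝ) - 1) • g (x * v ^ (2 : ℝ))) := fun v => by
    simp only [smul_eq_mul]
    ring
  simp only [h5, integral_const_mul] at h4
  rw [mul_comm 2 x, mul_assoc, h4]
  field_simp

/-- Mean value inequality on the convex half plane Re z ≥ 1, where |1/z| ≤ 1. -/
theorem norm_log_le {z : ℂ} (hz : 1 ≤ z.re) : ‖Complex.log z‖ ≤ ‖z - 1‖ := by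
  have h := Convex.norm_image_sub_le_of_norm_hasDerivWithin_le (𝕜 := ℂ) (f := Complex.log)
    (f' := fun z => z⁻¹) (s := {z : ℂ | 1 ≤ z.re}) (x := 1) (y := z) (C := 1)
    (fun w hw => (Complex.hasDerivAt_log (Or.inl (zero_lt_one.trans_le hw))).hasDerivWithinAt)
    (fun w hw => ?_) (convex_halfSpace_re_ge 1) (by simp) hz
  · simpa using h
  · have : 1 ≤ w.re := hw
    rw [norm_inv]
    exact inv_le_one_of_one_le₀ (this.trans (Complex.re_le_norm w))

theorem add_rootFn_re_pos (v : ℝ) : 0 < ((v : ℂ) + rootFn v).re := by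
  rw [Complex.add_re, Complex.ofReal_re]
  linarith [abs_lt_rootFn_re v, neg_abs_le v]

/-- The antiderivative of the density of `reprZero`, of inverse hyperbolic sine type; it makes the
logarithm at the origin visible. -/
theorem hasDerivAt_log_add_rootFn (v : ℝ) :
    HasDerivAt (fun v : ℝ => 2 * Complex.log (v + rootFn v)) (2 / rootFn v) v := by
  have h := (((hasDerivAt_id v).ofReal_comp.add (hasDerivAt_rootFn v)).clog_real
    (Or.inl (add_rootFn_re_pos v))).const_mul 2
  refine h.congr_deriv ?_
  have h1 := rootFn_ne_zero v
  have h2 : (v : ℂ) + rootFn v ≠ 0 := fun h => by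
    have := add_rootFn_re_pos v
    rw [h] at this
    simp at this
  simp only [id, Complex.ofReal_one, Pi.add_apply]
  field_simp
  ring

theorem norm_log_add_rootFn_le {v : ℝ} (hv : 0 ≤ v) :
    ‖2 * Complex.log (v + rootFn v)‖ ≤ 8 * (1 + v ^ 2) ^ 1 := by
  have h1 : 1 ≤ ((v : ℂ) + rootFn v).re := by
    rw [Complex.add_re, Complex.ofReal_re]
    linarith [one_le_rootFn_re v]
  have h2 := norm_log_le h1
  have h3 : ‖(v : ℂ) + rootFn v - 1‖ ≤ v + 2 * (1 + v ^ 2) + 1 := by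
    refine (norm_sub_le _ _).trans ?_
    rw [norm_one]
    gcongr
    refine (norm_add_le _ _).trans ?_
    rw [Complex.norm_real, Real.norm_of_nonneg hv]
    gcongr
    exact norm_rootFn_le v
  rw [norm_mul, Complex.norm_ofNat]
  nlinarith [sq_nonneg (v - 1)]

/-- Factor out 2v: the remaining z has Re z ≥ 1 and z - 1 = i / (v (v + `rootFn v`)), so its
logarithm is small enough to compensate the factor v. -/
theorem norm_mul_log_sub_le {v : ℝ} (hv : 0 < v) :
    ‖v * (2 * Complex.log (v + rootFn v)) - ((2 * v * Real.log (2 * v) : ℝ) : ℂ)‖ ≤ 2 := by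
  set z : ℂ := ((v : ℂ) + rootFn v) / (2 * v : ℝ)
  have hv2 : (0 : ℝ) < 2 * v := by positivity
  have hv' : (v : ℂ) ≠ 0 := by exact_mod_cast hv.ne'
  have h0 : (v : ℂ) + rootFn v ≠ 0 := fun h => by
    have := add_rootFn_re_pos v
    rw [h] at this
    simp at this
  have hz : 1 ≤ z.re := by
    rw [Complex.div_ofReal_re, le_div_iff₀ hv2, Complex.add_re, Complex.ofReal_re]
    linarith [abs_lt_rootFn_re v, le_abs_self v]
  have hz0 : z ≠ 0 := fun h => by rw [h] at hz; norm_num at hz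
  have h1 : (v : ℂ) + rootFn v = (2 * v : ℝ) * z := by
    simp only [z]
    push_cast
    field_simp
  have h2 : Complex.log (v + rootFn v) = (Real.log (2 * v) : ℝ) + Complex.log z := by
    rw [h1, Complex.log_ofReal_mul hv2 hz0]
  have h3 : z - 1 = Complex.I / (v * (v + rootFn v)) := by
    have h4 := rootFn_sq v
    simp only [z]
    push_cast
    field_simp
    linear_combination h4
  have h5 : v * (2 * Complex.log (v + rootFn v)) - ((2 * v * Real.log (2 * v) : ℝ) : ℂ) =
      2 * v * Complex.log z := by
    rw [h2]
    push_cast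
    ring
  have h6 : 1 ≤ ‖(v : ℂ) + rootFn v‖ := by
    refine le_trans ?_ (Complex.re_le_norm _)
    rw [Complex.add_re, Complex.ofReal_re]
    linarith [one_le_rootFn_re v]
  have h7 := norm_log_le hz
  rw [h3, norm_div, Complex.norm_I, norm_mul, Complex.norm_real, Real.norm_of_nonneg hv.le] at h7
  rw [h5, norm_mul, norm_mul, Complex.norm_ofNat, Complex.norm_real, Real.norm_of_nonneg hv.le]
  calc 2 * v * ‖Complex.log z‖ ≤ 2 * v * (1 / (v * ‖(v : ℂ) + rootFn v‖)) := by gcongr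
    _ = 2 / ‖(v : ℂ) + rootFn v‖ := by field_simp
    _ ≤ 2 := div_le_self zero_le_two h6

theorem two_mul_log_rootFn_zero :
    2 * Complex.log (rootFn 0) = Real.log 2 + Real.pi / 2 * Complex.I := by
  have h1 : Complex.log (2 * Complex.I) = Real.log 2 + Real.pi / 2 * Complex.I := by
    have := Complex.log_ofReal_mul two_pos Complex.I_ne_zero
    rw [Complex.log_I] at this
    exact_mod_cast this
  have h2 : rootFn 0 = Complex.exp (Complex.log (2 * Complex.I) / 2) := by
    rw [rootFn, Complex.cpow_def_of_ne_zero (Complex.slitPlane_ne_zero (sq_add_mem_slitPlane 0))]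
    simp [div_eq_mul_inv]
  have h3 : (Complex.log (2 * Complex.I) / 2).im = Real.pi / 4 := by
    rw [Complex.div_ofNat_im, h1]
    rw [Complex.add_im, Complex.ofReal_im]
    simp
    ring
  rw [h2, Complex.log_exp (by rw [h3]; linarith [Real.pi_pos]) (by rw [h3]; linarith [Real.pi_pos]),
    ← h1]
  ring

/-- Integrate by parts with 2 log(v + `rootFn v`), then replace this by 2 log(2v), whose transform
`log_gaussian` evaluates exactly. The boundary term supplies -log 2 - iπ/2. -/
theorem norm_reprZero_add_log_le {x : ℝ} (hx : 0 < x) :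
    ‖reprZero x - Complex.exp (-x * Complex.I) * (Real.log 2 - Real.pi / 2 * Complex.I -
      Real.eulerMascheroniConstant - Real.log x)‖ ≤ 2 * (x * √(Real.pi / x)) := by
  have hw := continuous_rootFn
  have hcl : Continuous fun v : ℝ => 2 * Complex.log (v + rootFn v) :=
    continuous_iff_continuousAt.2 fun v => (hasDerivAt_log_add_rootFn v).continuousAt
  have h1 := integral_gauss_of_hasDerivAt hcl continuous_two_div_rootFn
    (fun v _ => hasDerivAt_log_add_rootFn v) (fun v hv => norm_log_add_rootFn_le hv)
    (fun v _ => (norm_two_div_rootFn_le v).trans (by nlinarith [sq_nonneg v])) hx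
  rw [Complex.ofReal_zero, zero_add, two_mul_log_rootFn_zero] at h1
  obtain ⟨hli, hl⟩ := log_gaussian hx
  have hl2 : 2 * x * gaussTransform (fun v => ((2 * v * Real.log (2 * v) : ℝ) : ℂ)) x =
      Complex.exp (-x * Complex.I) *
        ((2 * Real.log 2 - Real.eulerMascheroniConstant - Real.log x : ℝ) : ℂ) := by
    rw [← hl, gaussTransform_eq, ← integral_complex_ofReal, mul_left_comm, ← integral_const_mul]
    congr 2
    funext v
    push_cast
    ring
  have hi1 : IntegrableOn (fun v : ℝ => v * (2 * Complex.log (v + rootFn v)) *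
      Complex.exp (-x * ((v : ℂ) ^ 2 + Complex.I))) (Ioi 0) := by
    refine integrableOn_gauss (q := fun v => v * (2 * Complex.log (v + rootFn v))) (by fun_prop)
      (C := 8) (n := 2) (fun v hv => ?_) hx
    rw [norm_mul, Complex.norm_real, Real.norm_of_nonneg hv]
    have := norm_log_add_rootFn_le hv
    calc v * _ ≤ (1 + v ^ 2) * (8 * (1 + v ^ 2) ^ 1) := by
          gcongr
          nlinarith [sq_nonneg (v - 1)]
      _ = _ := by ring
  have hi2 : IntegrableOn (fun v : ℝ => ((2 * v * Real.log (2 * v) : ℝ) : ℂ) *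
      Complex.exp (-x * ((v : ℂ) ^ 2 + Complex.I))) (Ioi 0) := by
    have h2 : IntegrableOn (fun v : ℝ =>
        ((4 * x * v * Real.log (2 * v) * Real.exp (-x * v ^ 2) : ℝ) : ℂ)) (Ioi 0) := hli.ofReal
    refine (h2.const_mul (Complex.exp (-x * Complex.I) / (2 * x))).congr (.of_forall fun v => ?_)
    have hx' : (x : ℂ) ≠ 0 := by exact_mod_cast hx.ne'
    simp only [kernel_eq]
    push_cast
    field_simp
    ring
  have h3 : reprZero x - Complex.exp (-x * Complex.I) * (Real.log 2 - Real.pi / 2 * Complex.I -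
      Real.eulerMascheroniConstant - Real.log x) =
      2 * x * gaussTransform (fun v => v * (2 * Complex.log (v + rootFn v)) -
        ((2 * v * Real.log (2 * v) : ℝ) : ℂ)) x := by
    rw [← gaussTransform_sub hi1 hi2, reprZero, h1]
    generalize gaussTransform (fun v => ((2 * v * Real.log (2 * v) : ℝ) : ℂ)) x = G at hl2 ⊢
    push_cast at hl2 ⊢
    linear_combination hl2
  have h4 : ‖gaussTransform (fun v => v * (2 * Complex.log (v + rootFn v)) -
      ((2 * v * Real.log (2 * v) : ℝ) : ℂ)) x‖ ≤ √(Real.pi / x) * (2 / 2 + 0 / (4 * x)) := by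
    refine norm_gaussTransform_le hx fun v hv => ?_
    rcases hv.eq_or_lt with rfl | hv
    · simp
    · simpa using norm_mul_log_sub_le hv
  rw [h3, norm_mul, norm_mul, Complex.norm_ofNat, Complex.norm_real, Real.norm_of_nonneg hx.le]
  calc 2 * x * _ ≤ 2 * x * (√(Real.pi / x) * (2 / 2 + 0 / (4 * x))) := by gcongr
    _ = _ := by ring

theorem tendsto_reprZero_add_log : Tendsto (fun x : ℝ => reprZero x + Real.log x) (𝓝[>] 0)
    (𝓝 (Real.log 2 - Real.pi / 2 * Complex.I - Real.eulerMascheroniConstant)) := by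
  set b : ℂ := Real.log 2 - Real.pi / 2 * Complex.I - Real.eulerMascheroniConstant
  have h1 : Tendsto (fun x : ℝ => Complex.exp (-x * Complex.I) * b) (𝓝[>] 0) (𝓝 b) := by
    have : Tendsto (fun x : ℝ => Complex.exp (-x * Complex.I) * b) (𝓝 0)
      (𝓝 (Complex.exp (-(0 : ℝ) * Complex.I) * b)) := Continuous.tendsto (by fun_prop) 0
    rw [Complex.ofReal_zero, neg_zero, zero_mul, Complex.exp_zero, one_mul] at this
    exact this.mono_left nhdsWithin_le_nhds
  have h2 : Tendsto (fun x : ℝ => reprZero x - Complex.exp (-x * Complex.I) * (b - Real.log x))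
      (𝓝[>] 0) (𝓝 0) := by
    refine squeeze_zero_norm' ?_ (by simpa using tendsto_mul_sqrt_pi_div.const_mul 2)
    filter_upwards [self_mem_nhdsWithin] with x hx
    exact norm_reprZero_add_log_le hx
  have h3 : Tendsto (fun x : ℝ => (1 - Complex.exp (-x * Complex.I)) * Real.log x)
      (𝓝[>] 0) (𝓝 0) := by
    have h4 : Tendsto (fun x : ℝ => |Real.log x * x|) (𝓝[>] 0) (𝓝 0) := by
      simpa using (tendsto_log_mul_rpow_nhdsGT_zero zero_lt_one).abs
    refine squeeze_zero_norm (fun x => ?_) h4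
    have h5 := Real.norm_exp_I_mul_ofReal_sub_one_le (x := -x)
    rw [norm_neg, Real.norm_eq_abs, mul_comm, Complex.ofReal_neg] at h5
    rw [norm_mul, Complex.norm_real, Real.norm_eq_abs, abs_mul, norm_sub_rev, mul_comm]
    gcongr
  have h6 := (h2.add h1).add h3
  rw [zero_add, add_zero] at h6
  refine h6.congr fun x => ?_
  ring

/-! ### Identification with the Hankel functions -/

/-- The constants at the origin agree: the term -iπ/2 in the limit for `reprZero`, multiplied by
2i/π, gives J_0(0) = 1, and the terms in γ and log 2 match. -/
theorem hankel2_eq {x : ℝ} (hx : 0 < x) :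
    hankel2 0 x = 2 * Complex.I / Real.pi * reprZero x ∧
    hankel2 1 x = 2 * Complex.I / Real.pi * reprOne x := by
  have hpi : (Real.pi : ℂ) ≠ 0 := by exact_mod_cast Real.pi_ne_zero
  have h := bessel_system_unique
    (f := fun x => hankel2 0 x - 2 * Complex.I / Real.pi * reprZero x)
    (g := fun x => hankel2 1 x - 2 * Complex.I / Real.pi * reprOne x)
    (fun y hy => ?_) (fun y hy => ?_) ?_ ?_ hx
  · exact ⟨sub_eq_zero.1 h.1, sub_eq_zero.1 h.2⟩
  · refine ((hasDerivAt_hankel2_zero hy).sub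
      ((hasDerivAt_reprZero hy).const_mul (2 * Complex.I / (Real.pi : ℂ)))).congr_deriv ?_
    ring
  · refine ((hasDerivAt_hankel2_one hy).sub
      ((hasDerivAt_reprOne hy).const_mul (2 * Complex.I / (Real.pi : ℂ)))).congr_deriv ?_
    ring
  · have h1 := tendsto_hankel2_zero_sub_log.sub
      (tendsto_reprZero_add_log.const_mul (2 * Complex.I / (Real.pi : ℂ)))
    have h2 := h1.add_const (2 * Complex.I / (Real.pi : ℂ) * Real.log 2)
    have h3 : 1 - 2 * Complex.I / (Real.pi : ℂ) * Real.eulerMascheroniConstant -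
        2 * Complex.I / (Real.pi : ℂ) *
          (Real.log 2 - Real.pi / 2 * Complex.I - Real.eulerMascheroniConstant) +
        2 * Complex.I / (Real.pi : ℂ) * Real.log 2 = 0 := by
      field_simp
      linear_combination (Real.pi : ℂ) * Complex.I_sq
    rw [h3] at h2
    refine h2.congr' ?_
    filter_upwards [self_mem_nhdsWithin] with y hy
    have hy' : 0 < y := hy
    rw [Real.log_div hy'.ne' two_ne_zero]
    push_cast
    ring
  · have h1 := tendsto_mul_hankel2_one.sub
      (tendsto_mul_reprOne.const_mul (2 * Complex.I / (Real.pi : ℂ)))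
    rw [mul_one, sub_self] at h1
    refine h1.congr fun y => ?_
    ring

/-! ### Large-argument asymptotics of `c` and `d`. -/

theorem norm_sq_rootFn_zero : ‖rootFn 0‖ ^ 2 = 2 := by
  rw [← norm_pow, rootFn_sq]
  simp

theorem sqrt_mul_sqrt {x : ℝ} (hx : 0 < x) :
    √(Real.pi * x / 8) * √(Real.pi / x) = √(Real.pi ^ 2 / 8) := by
  rw [← Real.sqrt_mul (by positivity)]
  congr 1
  field_simp

theorem sqrt_pi_sq_div_le : √(Real.pi ^ 2 / 8) * (2 / Real.pi) ≤ 1 := by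
  have hp := Real.pi_pos
  rw [← le_div_iff₀ (by positivity), Real.sqrt_le_left (by positivity)]
  field_simp
  nlinarith [sq_nonneg Real.pi]

/-- Asymptotics of the coefficient functions `c` and `d`. -/
theorem exists_asymptotics : ∃ w : ℂ, ‖w‖ = 1 ∧ ∀ x : ℝ, 0 < x →
    ‖c x - w * Complex.exp (-x * Complex.I)‖ ≤ 2 / x ∧ ‖d x‖ ≤ 2 / x := by
  have hp := Real.pi_pos
  have hpi : (Real.pi : ℂ) ≠ 0 := by exact_mod_cast hp.ne'
  have hw0 := rootFn_ne_zero 0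
  have hn : ‖(2 * Complex.I / (Real.pi : ℂ))‖ = 2 / Real.pi := by
    rw [norm_div, norm_mul, Complex.norm_I, Complex.norm_ofNat, Complex.norm_real,
      Real.norm_of_nonneg hp.le, mul_one]
  -- The leading terms of H_0 and -iH_1 are equal, which doubles the amplitude in c; after
  -- conjugation they are opposite and cancel in d. The modulus is (1/√2) · (2/√2) = 1.
  refine ⟨(√(Real.pi ^ 2 / 8) : ℝ) * (2 * Complex.I / Real.pi) * (2 / rootFn 0), ?_, fun x hx => ?_⟩
  · rw [norm_mul, norm_mul, hn, Complex.norm_real, Real.norm_of_nonneg (by positivity), norm_div,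
      Complex.norm_ofNat]
    refine (sq_eq_sq₀ (by positivity) zero_le_one).1 ?_
    rw [mul_pow, mul_pow, Real.sq_sqrt (by positivity), div_pow, div_pow, norm_sq_rootFn_zero]
    field_simp
    norm_num
  set s := √(Real.pi * x / 8)
  set r := √(Real.pi / x)
  have hsr : s * r = √(Real.pi ^ 2 / 8) := sqrt_mul_sqrt hx
  have hs : 0 ≤ s := Real.sqrt_nonneg _
  have hx' : (x : ℂ) ≠ 0 := by exact_mod_cast hx.ne'
  obtain ⟨h0, h1⟩ := hankel2_eq hx
  set u := reprZero x - Complex.exp (-x * Complex.I) * (r / rootFn 0)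
  set v := reprOne x - Complex.exp (-x * Complex.I) * (Complex.I * r / rootFn 0)
  have hu : ‖u‖ ≤ r * (1 / (4 * x)) := norm_reprZero_sub_le hx
  have hv : ‖v‖ ≤ r * (3 / (4 * x)) := norm_reprOne_sub_le hx
  have hz : ‖reprZero x‖ ≤ r := norm_reprZero_le hx
  have hq : ‖Complex.I / (2 * (x : ℂ))‖ = 1 / (2 * x) := by
    rw [norm_div, Complex.norm_I, norm_mul, Complex.norm_ofNat, Complex.norm_real,
      Real.norm_of_nonneg hx.le]
  -- The three errors 1/(4x), 1/(2x) and 3/(4x), from H_0, from its correction i/(2x) and from H_1,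
  -- add up to 3/(2x).
  have hfin : s * (2 / Real.pi) * (r * (3 / (2 * x))) ≤ 2 / x := by
    have h2 : s * (2 / Real.pi) * (r * (3 / (2 * x))) =
        √(Real.pi ^ 2 / 8) * (2 / Real.pi) * (3 / (2 * x)) := by
      rw [← hsr]
      ring
    rw [h2]
    refine (mul_le_mul_of_nonneg_right sqrt_pi_sq_div_le (by positivity)).trans ?_
    rw [one_mul, div_le_div_iff₀ (by positivity) hx]
    linarith
  constructor
  · have h2 : c x - (√(Real.pi ^ 2 / 8) : ℝ) * (2 * Complex.I / Real.pi) * (2 / rootFn 0) *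
        Complex.exp (-x * Complex.I) = s * (2 * Complex.I / Real.pi) *
          (u + Complex.I / (2 * (x : ℂ)) * reprZero x - Complex.I * v) := by
      rw [c, h0, h1, ← hsr]
      simp only [u, v]
      generalize Complex.exp (-(x : ℂ) * Complex.I) = E
      push_cast
      field_simp
      linear_combination (-2 * s * x * r * E) * Complex.I_sq
    rw [h2, norm_mul, norm_mul, hn, Complex.norm_real, Real.norm_of_nonneg hs]
    refine le_trans ?_ hfin
    gcongr
    refine (norm_sub_le _ _).trans ?_
    rw [norm_mul Complex.I, Complex.norm_I, one_mul]
    have h3 : ‖u + Complex.I / (2 * (x : ℂ)) * reprZero x‖ ≤ r * (1 / (4 * x)) + 1 / (2 * x) * r := by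
      refine (norm_add_le _ _).trans ?_
      rw [norm_mul, hq]
      gcongr
    calc _ ≤ r * (1 / (4 * x)) + 1 / (2 * x) * r + r * (3 / (4 * x)) := add_le_add h3 hv
      _ = _ := by
        field_simp
        ring
  · have h2 : d x = s * (-(2 * Complex.I / Real.pi)) *
          (conj u + Complex.I / (2 * (x : ℂ)) * conj (reprZero x) - Complex.I * conj v) := by
      rw [d, h0, h1]
      simp only [u, v, map_mul, map_sub, map_div₀, Complex.conj_I, Complex.conj_ofReal,
        Complex.conj_ofNat]
      have hw0' : conj (rootFn 0) ≠ 0 := by simpa using hw0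
      generalize conj (Complex.exp (-(x : ℂ) * Complex.I)) = E
      field_simp
      linear_combination (-2 * s * x * r * E) * Complex.I_sq
    rw [h2, norm_mul, norm_mul, norm_neg, hn, Complex.norm_real, Real.norm_of_nonneg hs]
    refine le_trans ?_ hfin
    gcongr
    refine (norm_sub_le _ _).trans ?_
    rw [norm_mul Complex.I, Complex.norm_I, one_mul, Complex.norm_conj]
    have h3 : ‖conj u + Complex.I / (2 * (x : ℂ)) * conj (reprZero x)‖ ≤
        r * (1 / (4 * x)) + 1 / (2 * x) * r := by
      refine (norm_add_le _ _).trans ?_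
      rw [norm_mul, hq, Complex.norm_conj, Complex.norm_conj]
      gcongr
    calc _ ≤ r * (1 / (4 * x)) + 1 / (2 * x) * r + r * (3 / (4 * x)) := add_le_add h3 hv
      _ = _ := by
        field_simp
        ring

/-! ### The evolution coefficients at late times -/

theorem continuousOn_c : ContinuousOn c (Ioi 0) := by
  have h0 : ContinuousOn (hankel2 0) (Ioi 0) := fun x hx =>
    (hasDerivAt_hankel2_zero hx).continuousAt.continuousWithinAt
  have h1 : ContinuousOn (hankel2 1) (Ioi 0) := fun x hx =>
    (hasDerivAt_hankel2_one hx).continuousAt.continuousWithinAt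
  have h2 : ContinuousOn (fun x : ℝ => 1 + Complex.I / (2 * (x : ℂ))) (Ioi 0) := by
    refine continuousOn_const.add (continuousOn_const.div (by fun_prop) fun x hx => ?_)
    have : (x : ℂ) ≠ 0 := by exact_mod_cast (ne_of_gt hx)
    simpa using this
  have h3 : ContinuousOn (fun x : ℝ => (√(Real.pi * x / 8) : ℂ)) (Ioi 0) := by fun_prop
  exact h3.mul ((h2.mul h0).sub (continuousOn_const.mul h1))

theorem continuousOn_d : ContinuousOn d (Ioi 0) := by
  have h0 : ContinuousOn (fun x => conj (hankel2 0 x)) (Ioi 0) := fun x hx =>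
    (Complex.continuous_conj.continuousAt.comp
      (hasDerivAt_hankel2_zero hx).continuousAt).continuousWithinAt
  have h1 : ContinuousOn (fun x => conj (hankel2 1 x)) (Ioi 0) := fun x hx =>
    (Complex.continuous_conj.continuousAt.comp
      (hasDerivAt_hankel2_one hx).continuousAt).continuousWithinAt
  have h2 : ContinuousOn (fun x : ℝ => 1 + Complex.I / (2 * (x : ℂ))) (Ioi 0) := by
    refine continuousOn_const.add (continuousOn_const.div (by fun_prop) fun x hx => ?_)
    have : (x : ℂ) ≠ 0 := by exact_mod_cast (ne_of_gt hx)
    simpa using this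
  have h3 : ContinuousOn (fun x : ℝ => (√(Real.pi * x / 8) : ℂ)) (Ioi 0) := by fun_prop
  exact h3.mul ((h2.mul h0).sub (continuousOn_const.mul h1))

theorem one_le_cast (m : ℕ+) : (1 : ℝ) ≤ m := by exact_mod_cast m.pos

/-- The cut-off `max τ 0` changes nothing for τ ≥ 0 and makes the coefficient continuous, hence
measurable, on the whole line. -/
theorem continuous_alpha (m : ℕ+) {t₀ : ℝ} (ht₀ : 0 < t₀) :
    Continuous fun τ : ℝ => alpha m (t₀ + max τ 0) t₀ := by
  have hmap : ∀ τ : ℝ, (m : ℝ) * (t₀ + max τ 0) ∈ Ioi (0 : ℝ) := fun τ => by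
    have := one_le_cast m
    have := le_max_right τ 0
    exact mul_pos (by linarith : (0 : ℝ) < m) (by linarith : 0 < t₀ + max τ 0)
  have h1 : Continuous fun τ : ℝ => c ((m : ℝ) * (t₀ + max τ 0)) :=
    continuousOn_c.comp_continuous (by fun_prop) hmap
  have h2 : Continuous fun τ : ℝ => d ((m : ℝ) * (t₀ + max τ 0)) :=
    continuousOn_d.comp_continuous (by fun_prop) hmap
  exact (h1.mul continuous_const).sub (h2.mul continuous_const)

/-- Both arguments of c and d are at least t₀ for every m, so with η = 2/t₀ ≤ 1 the error is at most
η(1 + η) + η + η² ≤ 4η, uniformly in m. -/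
theorem norm_alpha_sub_exp_le {m : ℕ+} {t₀ τ : ℝ} (ht₀ : 2 ≤ t₀) (hτ : 0 ≤ τ) :
    ‖alpha m (t₀ + τ) t₀ - Complex.exp (-((m * τ : ℝ) : ℂ) * Complex.I)‖ ≤ 8 / t₀ := by
  obtain ⟨w, hw, has⟩ := exists_asymptotics
  have hm := one_le_cast m
  have hx0 : t₀ ≤ m * t₀ := le_mul_of_one_le_left (by linarith) hm
  have hx1 : t₀ ≤ m * (t₀ + τ) :=
    (le_add_of_nonneg_right hτ).trans (le_mul_of_one_le_left (by linarith) hm)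
  have hb : ∀ x, t₀ ≤ x → ‖c x - w * Complex.exp (-x * Complex.I)‖ ≤ 2 / t₀ ∧ ‖d x‖ ≤ 2 / t₀ := by
    intro x hx
    have h := has x (by linarith)
    have h2 : 2 / x ≤ 2 / t₀ := by gcongr
    exact ⟨h.1.trans h2, h.2.trans h2⟩
  set x := (m : ℝ) * (t₀ + τ) with hx
  set y := (m : ℝ) * t₀ with hy
  have hη : 2 / t₀ ≤ 1 := by rw [div_le_one (by linarith)]; exact ht₀
  have hη0 : 0 ≤ 2 / t₀ := by positivity
  set η := 2 / t₀
  have hww : w * conj w = 1 := by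
    rw [Complex.mul_conj, Complex.normSq_eq_norm_sq, hw]
    simp
  have hexp : Complex.exp (-((m * τ : ℝ) : ℂ) * Complex.I) =
      w * Complex.exp (-x * Complex.I) * conj (w * Complex.exp (-y * Complex.I)) := by
    rw [map_mul, ← Complex.exp_conj, mul_mul_mul_comm, hww, one_mul, ← Complex.exp_add]
    congr 1
    simp only [map_mul, map_neg, Complex.conj_I, Complex.conj_ofReal, hx, hy]
    push_cast
    ring
  have h1 : alpha m (t₀ + τ) t₀ - Complex.exp (-((m * τ : ℝ) : ℂ) * Complex.I) =
      (c x - w * Complex.exp (-x * Complex.I)) * conj (c y) +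
      w * Complex.exp (-x * Complex.I) * conj (c y - w * Complex.exp (-y * Complex.I)) -
      d x * conj (d y) := by
    rw [hexp, alpha, map_sub]
    ring
  obtain ⟨hcx, hdx⟩ := hb x hx1
  obtain ⟨hcy, hdy⟩ := hb y hx0
  have hcy2 : ‖c y‖ ≤ 1 + η := by
    have := norm_add_le (c y - w * Complex.exp (-y * Complex.I)) (w * Complex.exp (-y * Complex.I))
    rw [sub_add_cancel, norm_mul w, norm_exp_neg_mul_I, hw] at this
    linarith
  have h2 : 8 / t₀ = 4 * η := by simp only [η]; ring
  rw [h1, h2]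
  refine (norm_sub_le _ _).trans ((add_le_add_left (norm_add_le _ _) _).trans ?_)
  rw [norm_mul, norm_mul, norm_mul w, norm_mul (d x), norm_exp_neg_mul_I, hw, Complex.norm_conj,
    Complex.norm_conj, Complex.norm_conj]
  have e1 : ‖c x - w * Complex.exp (-x * Complex.I)‖ * ‖c y‖ ≤ η * (1 + η) := by gcongr
  have e2 : ‖d x‖ * ‖d y‖ ≤ η * η := by gcongr
  nlinarith

theorem sq_ge_of_abs_sub_le {a b η : ℝ} (h : |a - b| ≤ η) (hη : η ≤ 1) (hb : |b| ≤ 1) :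
    a ^ 2 ≤ b ^ 2 + 3 * η ∧ b ^ 2 - 3 * η ≤ a ^ 2 := by
  rw [abs_le] at h hb
  constructor
  · nlinarith [mul_nonneg (sub_nonneg.2 h.1) (sub_nonneg.2 h.2)]
  · nlinarith [mul_nonneg (sub_nonneg.2 h.1) (sub_nonneg.2 h.2)]

theorem alpha_re_im_bounds {m : ℕ+} {t₀ τ : ℝ} (ht₀ : 8 ≤ t₀) (hτ : 0 ≤ τ) :
    Real.sin (m * τ) ^ 2 - 24 / t₀ ≤ 1 - (alpha m (t₀ + τ) t₀).re ^ 2 ∧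
    Real.sin (m * τ) ^ 2 - 24 / t₀ ≤ (alpha m (t₀ + τ) t₀).im ^ 2 := by
  have h := norm_alpha_sub_exp_le (m := m) (by linarith : 2 ≤ t₀) hτ
  have hη : 8 / t₀ ≤ 1 := by rw [div_le_one (by linarith)]; exact ht₀
  have h24 : 24 / t₀ = 3 * (8 / t₀) := by ring
  rw [← Complex.ofReal_neg] at h
  have hre := (Complex.abs_re_le_norm _).trans h
  have him := (Complex.abs_im_le_norm _).trans h
  rw [Complex.sub_re, Complex.exp_ofReal_mul_I_re, Real.cos_neg] at hre
  rw [Complex.sub_im, Complex.exp_ofReal_mul_I_im, Real.sin_neg] at him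
  have h1 := (sq_ge_of_abs_sub_le hre hη (Real.abs_cos_le_one _)).1
  have h2 := (sq_ge_of_abs_sub_le him hη (by rw [abs_neg]; exact Real.abs_sin_le_one _)).2
  rw [h24]
  constructor
  · nlinarith [Real.sin_sq_add_cos_sq (m * τ)]
  · nlinarith

theorem one_sub_sq_re_alpha_ge : ∀ ε ∈ Ioc (0 : ℝ) 1, ∃ T : ℝ, 0 < T ∧
    ∀ t₀ : ℝ, T < t₀ → ∀ τ ∈ Icc (0 : ℝ) Real.pi, ∀ m : ℕ+,
      1 - (alpha m (t₀ + τ) t₀).re ^ 2 ≥ Real.sin ((m : ℝ) * τ) ^ 2 - 26 * ε := by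
  intro ε hε
  -- Since ε ≤ 1 this forces t₀ ≥ 8; the error 24/t₀ is then even below 3ε.
  refine ⟨8 / ε, div_pos (by norm_num) hε.1, fun t₀ ht₀ τ hτ m => ?_⟩
  have h8 : 8 ≤ 8 / ε := by
    rw [le_div_iff₀ hε.1]
    linarith [hε.2]
  have h1 := (alpha_re_im_bounds (m := m) (h8.trans ht₀.le) hτ.1).1
  have h2 : 24 / t₀ ≤ 26 * ε := by
    rw [div_le_iff₀ (by linarith)]
    rw [div_lt_iff₀ hε.1] at ht₀
    linarith
  linarith

/-! ### Averages over large sets of times -/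

theorem integral_cos_sq_nat_mul (m : ℕ+) :
    ∫ τ in Icc (0 : ℝ) Real.pi, Real.cos (m * τ) ^ 2 = Real.pi / 2 := by
  have hm : (m : ℝ) ≠ 0 := by linarith [one_le_cast m]
  rw [integral_Icc_eq_integral_Ioc, ← intervalIntegral.integral_of_le Real.pi_pos.le,
    intervalIntegral.integral_comp_mul_left (fun x => Real.cos x ^ 2) hm, integral_cos_sq,
    Real.sin_nat_mul_pi]
  simp
  field_simp

/-- Write sin² = 1 - cos²: the constant contributes at least π - δ, and cos² over E at most its
integral π/2 over [0, π]. The bound does not depend on m. -/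
theorem setIntegral_ge_of_sin_sq_le {δ η : ℝ} (hη : 0 ≤ η) {E : Set ℝ}
    (hE : MeasurableSet E) (hsub : E ⊆ Icc 0 Real.pi)
    (hvol : ENNReal.ofReal (Real.pi - δ) < volume E) {f : ℝ → ℝ} (hf : Continuous f) (m : ℕ+)
    (hlow : ∀ τ ∈ Icc (0 : ℝ) Real.pi, Real.sin (m * τ) ^ 2 - η ≤ f τ) :
    Real.pi / 2 - δ - η * Real.pi ≤ ∫ τ in E, f τ := by
  have hi : ∀ {g : ℝ → ℝ}, Continuous g → IntegrableOn g E := fun hg =>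
    (hg.continuousOn.integrableOn_compact isCompact_Icc).mono_set hsub
  have hfin : volume E ≠ ⊤ := measure_ne_top_of_subset hsub (by simp)
  have hvol2 : Real.pi - δ ≤ volume.real E := by
    rw [Measure.real, ← ENNReal.ofReal_le_iff_le_toReal hfin]
    exact hvol.le
  have hvol3 : volume.real E ≤ Real.pi := by
    have := measureReal_mono hsub (by simp : volume (Icc (0 : ℝ) Real.pi) ≠ ⊤)
    simpa [Real.pi_pos.le] using this
  have hcos : ∫ τ in E, Real.cos (m * τ) ^ 2 ≤ Real.pi / 2 := by
    rw [← integral_cos_sq_nat_mul m]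
    exact setIntegral_mono_set (Continuous.integrableOn_Icc (by fun_prop))
      (.of_forall fun τ => sq_nonneg _) hsub.eventuallyLE
  have h1 : ∫ τ in E, (1 - η - Real.cos (m * τ) ^ 2) ≤ ∫ τ in E, f τ := by
    refine setIntegral_mono_on (hi (by fun_prop)) (hi hf) hE fun τ hτ => ?_
    have := hlow τ (hsub hτ)
    have := Real.sin_sq_add_cos_sq (m * τ)
    linarith
  rw [integral_sub (hi (by fun_prop)) (hi (by fun_prop)), setIntegral_const, smul_eq_mul] at h1
  nlinarith

theorem condition1_alpha : Condition1 alpha := by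
  have hp := Real.pi_gt_d2
  -- At t₀ = 120 the error 24/t₀ is 1/5, and π/2 - 1/2 - π/5 exceeds 2/5.
  refine ⟨120, by norm_num, 1 / 2, ⟨by norm_num, by linarith⟩, fun E hE hsub hvol =>
    ⟨2 / 5, by norm_num, fun m => ?_⟩⟩
  have hc := continuous_alpha m (t₀ := 120) (by norm_num)
  have h := setIntegral_ge_of_sin_sq_le (δ := 1 / 2) (η := 1 / 5) (by norm_num) hE hsub
    hvol (f := fun τ => 1 - (alpha m (120 + max τ 0) 120).re ^ 2)
    (by have := Complex.continuous_re.comp hc; simp only [Function.comp_def] at this; fun_prop) m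
    (fun τ hτ => ?_)
  · rw [setIntegral_congr_fun hE (g := fun τ => 1 - (alpha m (120 + τ) 120).re ^ 2)] at h
    · linarith
    · intro τ hτ
      simp only [max_eq_left (hsub hτ).1]
  · rw [max_eq_left hτ.1]
    have := (alpha_re_im_bounds (m := m) (t₀ := 120) (by norm_num) hτ.1).1
    norm_num at this ⊢
    linarith

/-- The sublevel sets of the sum exhaust [0, π], so one of them has measure above π - 1/2. The sum
has finite integral over it, while the average of each `f m` there is bounded below independently of
m. -/
theorem summable_of_forall_summable_mul {y : ℕ+ → ℝ} (hy : ∀ m, 0 ≤ y m) {f : ℕ+ → ℝ → ℝ}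
    (hf : ∀ m, Continuous (f m)) (hf0 : ∀ m τ, 0 ≤ f m τ)
    (hlow : ∀ m : ℕ+, ∀ τ ∈ Icc (0 : ℝ) Real.pi, Real.sin (m * τ) ^ 2 - 1 / 5 ≤ f m τ)
    (hs : ∀ τ ∈ Icc (0 : ℝ) Real.pi, Summable fun m => y m * f m τ) : Summable y := by
  have hp := Real.pi_gt_d2
  set S : ℝ → ENNReal := fun τ => ∑' m, ENNReal.ofReal (y m * f m τ)
  have hmeas : ∀ m, Measurable fun τ => ENNReal.ofReal (y m * f m τ) := fun m =>
    ((hf m).measurable.const_mul _).ennreal_ofReal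
  have hS : Measurable S := Measurable.tsum hmeas
  set E : ℕ → Set ℝ := fun N => Icc 0 Real.pi ∩ {τ | S τ ≤ N}
  have hEm : ∀ N, MeasurableSet (E N) := fun N =>
    measurableSet_Icc.inter (hS measurableSet_Iic)
  have hmono : Monotone E := fun M N h τ hτ =>
    ⟨hτ.1, (show S τ ≤ M from hτ.2).trans (by exact_mod_cast h)⟩
  have hU : ⋃ N, E N = Icc 0 Real.pi := by
    refine subset_antisymm (iUnion_subset fun N => inter_subset_left) fun τ hτ => ?_
    have hfin : S τ ≠ ⊤ := (hs τ hτ).tsum_ofReal_ne_top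
    obtain ⟨N, hN⟩ := ENNReal.exists_nat_gt hfin
    exact mem_iUnion.2 ⟨N, hτ, hN.le⟩
  have ht := tendsto_measure_iUnion_atTop (μ := volume) hmono
  rw [hU] at ht
  have hlt : ENNReal.ofReal (Real.pi - 1 / 2) < volume (Icc (0 : ℝ) Real.pi) := by
    rw [Real.volume_Icc]
    exact (ENNReal.ofReal_lt_ofReal_iff (by linarith)).2 (by linarith)
  obtain ⟨N, hN⟩ := (ht.eventually_const_lt hlt).exists
  have hsub : E N ⊆ Icc 0 Real.pi := inter_subset_left
  have hupper : ∫⁻ τ in E N, S τ ≤ N * volume (E N) := by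
    rw [← setLIntegral_const]
    exact setLIntegral_mono measurable_const fun τ hτ => hτ.2
  have hEfin : volume (E N) ≠ ⊤ := measure_ne_top_of_subset hsub (by simp)
  have hterm : ∀ m, ENNReal.ofReal (y m * (2 / 5)) ≤
      ∫⁻ τ in E N, ENNReal.ofReal (y m * f m τ) := fun m => by
    rw [← ofReal_integral_eq_lintegral_ofReal]
    · refine ENNReal.ofReal_le_ofReal ?_
      rw [integral_const_mul]
      refine mul_le_mul_of_nonneg_left ?_ (hy m)
      have := setIntegral_ge_of_sin_sq_le (δ := 1 / 2) (η := 1 / 5) (by norm_num)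
        (hEm N) hsub hN (hf m) m (hlow m)
      linarith
    · exact (((hf m).const_mul (y m)).continuousOn.integrableOn_compact isCompact_Icc).mono_set hsub
    · exact .of_forall fun τ => mul_nonneg (hy m) (hf0 m τ)
  have hsum : ∑' m, ENNReal.ofReal (y m * (2 / 5)) ≠ ⊤ := by
    refine ne_top_of_le_ne_top (ENNReal.mul_ne_top (ENNReal.natCast_ne_top N) hEfin)
      (le_trans ?_ hupper)
    rw [lintegral_tsum fun m => (hmeas m).aemeasurable]
    exact ENNReal.tsum_le_tsum hterm
  have h := ENNReal.summable_toReal hsum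
  refine (h.mul_right (5 / 2)).congr fun m => ?_
  rw [ENNReal.toReal_ofReal (mul_nonneg (hy m) (by norm_num))]
  ring

/-! ### Square summability of the antilinear coefficients -/

/-- Each product in β_m contains one factor d, so β_m = O(1/m) for fixed times. -/
theorem summable_norm_beta_sq {t t₀ : ℝ} (ht : 0 < t) (ht₀ : 0 < t₀) :
    Summable fun m : ℕ+ => ‖beta m t t₀‖ ^ 2 := by
  obtain ⟨w, hw, has⟩ := exists_asymptotics
  have hb : ∀ s : ℝ, 0 < s → ∀ m : ℕ+, ‖c (m * s)‖ ≤ 1 + 2 / s ∧ ‖d (m * s)‖ ≤ 2 / s / m := by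
    intro s hs m
    have hm := one_le_cast m
    obtain ⟨h1, h2⟩ := has (m * s) (by positivity)
    have h3 : 2 / ((m : ℝ) * s) = 2 / s / m := by
      rw [div_div, mul_comm]
    rw [h3] at h1 h2
    refine ⟨?_, h2⟩
    have h4 := norm_add_le (c (m * s) - w * Complex.exp (-(m * s : ℝ) * Complex.I))
      (w * Complex.exp (-(m * s : ℝ) * Complex.I))
    rw [sub_add_cancel, norm_mul w, norm_exp_neg_mul_I, hw] at h4
    have h5 : 2 / s / m ≤ 2 / s := div_le_self (by positivity) hm
    linarith
  set M := 2 / t * (1 + 2 / t₀) + (1 + 2 / t) * (2 / t₀)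
  have hs : Summable fun m : ℕ+ => M ^ 2 * (1 / (m : ℝ) ^ 2) :=
    ((Real.summable_one_div_nat_pow.2 one_lt_two).comp_injective PNat.coe_injective).mul_left _
  refine Summable.of_nonneg_of_le (fun m => sq_nonneg _) (fun m => ?_) hs
  have hm := one_le_cast m
  obtain ⟨h1, h2⟩ := hb t ht m
  obtain ⟨h3, h4⟩ := hb t₀ ht₀ m
  have h5 : ‖beta m t t₀‖ ≤ M / m := by
    rw [beta]
    refine (norm_sub_le _ _).trans ?_
    rw [norm_mul, norm_mul]
    calc _ ≤ 2 / t / m * (1 + 2 / t₀) + (1 + 2 / t) * (2 / t₀ / m) := by gcongr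
      _ = M / m := by simp only [M]; ring
  calc ‖beta m t t₀‖ ^ 2 ≤ (M / m) ^ 2 := by gcongr
    _ = _ := by ring

/-! ### The symplectic form on a single pair of modes -/

/-- The symplectic form on one pair of modes. -/
noncomputable def pairForm (z w : ℂ × ℂ) : ℝ := (-2) * ((conj z.1 * w.1).im + (conj z.2 * w.2).im)

/-- The squared norm on one pair of modes. -/
noncomputable def pairNormSq (z : ℂ × ℂ) : ℝ := ‖z.1‖ ^ 2 + ‖z.2‖ ^ 2

theorem pairNormSq_nonneg (z : ℂ × ℂ) : 0 ≤ pairNormSq z := by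
  unfold pairNormSq
  positivity

theorem pairNormSq_eq (z : ℂ × ℂ) :
    pairNormSq z = z.1.re ^ 2 + z.1.im ^ 2 + z.2.re ^ 2 + z.2.im ^ 2 := by
  rw [pairNormSq, Complex.sq_norm, Complex.sq_norm, Complex.normSq_apply, Complex.normSq_apply]
  ring

theorem pairForm_eq (z w : ℂ × ℂ) : pairForm z w = (-2) * (z.1.re * w.1.im - z.1.im * w.1.re +
    (z.2.re * w.2.im - z.2.im * w.2.re)) := by
  simp [pairForm]
  ring

theorem pairForm_swap (z w : ℂ × ℂ) : pairForm z w = -pairForm w z := by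
  rw [pairForm_eq, pairForm_eq]
  ring

theorem abs_pairForm_le (z w : ℂ × ℂ) : |pairForm z w| ≤ 2 * (pairNormSq z + pairNormSq w) := by
  rw [pairForm_eq, pairNormSq_eq, pairNormSq_eq, abs_le]
  constructor
  · nlinarith [sq_nonneg (z.1.re - w.1.im), sq_nonneg (z.1.im + w.1.re),
      sq_nonneg (z.2.re - w.2.im), sq_nonneg (z.2.im + w.2.re)]
  · nlinarith [sq_nonneg (z.1.re + w.1.im), sq_nonneg (z.1.im - w.1.re),
      sq_nonneg (z.2.re + w.2.im), sq_nonneg (z.2.im - w.2.re)]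

theorem pairForm_zero_left (w : ℂ × ℂ) : pairForm 0 w = 0 := by simp [pairForm]

theorem pairForm_zero_right (w : ℂ × ℂ) : pairForm w 0 = 0 := by simp [pairForm]

theorem pairForm_add_left (z z' w : ℂ × ℂ) :
    pairForm (z + z') w = pairForm z w + pairForm z' w := by
  simp only [pairForm_eq, Prod.fst_add, Prod.snd_add, Complex.add_re, Complex.add_im]
  ring

theorem pairForm_smul_left (r : ℝ) (z w : ℂ × ℂ) : pairForm (r • z) w = r * pairForm z w := by
  simp only [pairForm_eq, Prod.smul_fst, Prod.smul_snd, Complex.smul_re, Complex.smul_im,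
    smul_eq_mul]
  ring

theorem pairForm_add_right (z w w' : ℂ × ℂ) :
    pairForm z (w + w') = pairForm z w + pairForm z w' := by
  rw [pairForm_swap, pairForm_add_left, pairForm_swap w, pairForm_swap w']
  ring

theorem pairForm_smul_right (r : ℝ) (z w : ℂ × ℂ) : pairForm z (r • w) = r * pairForm z w := by
  rw [pairForm_swap, pairForm_smul_left, pairForm_swap w]
  ring

theorem eq_of_pairForm_eq {a b : ℂ × ℂ} (h : ∀ z, pairForm a z = pairForm b z) : a = b := by
  have h1 := h (1, 0)
  have h2 := h (Complex.I, 0)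
  have h3 := h (0, 1)
  have h4 := h (0, Complex.I)
  simp [pairForm_eq] at h1 h2 h3 h4
  exact Prod.ext (Complex.ext h2 h1) (Complex.ext h4 h3)

/-! ### The symplectic form on the phase space -/

variable {V : Submodule ℝ Modes}

theorem symp_eq_tsum (v w : Modes) : symp v w = ∑' m, pairForm (v m) (w m) := rfl

theorem IsPhaseSpace.summable_pairNormSq (hV : IsPhaseSpace V) (v : V) :
    Summable fun m => pairNormSq ((v : Modes) m) := hV.summable v v.2

theorem IsPhaseSpace.summable_pairForm (hV : IsPhaseSpace V) (v w : V) :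
    Summable fun m => pairForm ((v : Modes) m) ((w : Modes) m) :=
  Summable.of_norm_bounded
    (((hV.summable_pairNormSq v).add (hV.summable_pairNormSq w)).mul_left 2)
    fun _ => abs_pairForm_le _ _

/-- The symplectic form of a phase space as a bilinear map. -/
noncomputable def IsPhaseSpace.form (hV : IsPhaseSpace V) : V →ₗ[ℝ] V →ₗ[ℝ] ℝ :=
  LinearMap.mk₂ ℝ (fun v w => symp (v : Modes) (w : Modes))
    (fun v v' w => by
      rw [symp_eq_tsum, symp_eq_tsum, symp_eq_tsum,
        ← (hV.summable_pairForm v w).tsum_add (hV.summable_pairForm v' w)]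
      exact tsum_congr fun m => pairForm_add_left _ _ _)
    (fun r v w => by
      rw [symp_eq_tsum, symp_eq_tsum, smul_eq_mul, ← tsum_mul_left]
      exact tsum_congr fun m => pairForm_smul_left _ _ _)
    (fun v w w' => by
      rw [symp_eq_tsum, symp_eq_tsum, symp_eq_tsum,
        ← (hV.summable_pairForm v w).tsum_add (hV.summable_pairForm v w')]
      exact tsum_congr fun m => pairForm_add_right _ _ _)
    (fun r v w => by
      rw [symp_eq_tsum, symp_eq_tsum, smul_eq_mul, ← tsum_mul_left]
      exact tsum_congr fun m => pairForm_smul_right _ _ _)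

theorem IsPhaseSpace.form_apply (hV : IsPhaseSpace V) (v w : V) :
    hV.form v w = symp (v : Modes) (w : Modes) := rfl

theorem symp_eq_pairForm_of_right (m : ℕ+) (v w : Modes) (hw : ∀ n, n ≠ m → w n = 0) :
    symp v w = pairForm (v m) (w m) := by
  rw [symp_eq_tsum, tsum_eq_single m]
  intro n hn
  rw [hw n hn, pairForm_zero_right]

/-- Initial data with a single pair of modes. -/
def IsPhaseSpace.single (hV : IsPhaseSpace V) (m : ℕ+) (z : ℂ × ℂ) : V :=
  ⟨Pi.single m z, hV.single_mem m z⟩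

theorem IsPhaseSpace.single_same (hV : IsPhaseSpace V) (m : ℕ+) (z : ℂ × ℂ) :
    (hV.single m z : Modes) m = z := by
  simp [IsPhaseSpace.single]

theorem IsPhaseSpace.single_of_ne (hV : IsPhaseSpace V) {m n : ℕ+} (h : n ≠ m) (z : ℂ × ℂ) :
    (hV.single m z : Modes) n = 0 := by
  simp [IsPhaseSpace.single, h]

theorem IsPhaseSpace.symp_single (hV : IsPhaseSpace V) (m : ℕ+) (v : Modes) (z : ℂ × ℂ) :
    symp v (hV.single m z : Modes) = pairForm (v m) z := by
  rw [symp_eq_pairForm_of_right m v _ fun n hn => hV.single_of_ne hn z, hV.single_same]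

/-! ### The reference complex structure -/

theorem IsPhaseSpace.J0_apply (hV : IsPhaseSpace V) (v : V) (m : ℕ+) :
    (hV.J0 v : Modes) m = (Complex.I * ((v : Modes) m).1, Complex.I * ((v : Modes) m).2) := rfl

theorem IsPhaseSpace.translation_apply (hV : IsPhaseSpace V) (θ : ℝ) (v : V) (m : ℕ+) :
    (hV.translation θ v : Modes) m =
      (Complex.exp (Complex.I * ((m : ℝ) * θ : ℝ)) * ((v : Modes) m).1,
        Complex.exp (-(Complex.I * ((m : ℝ) * θ : ℝ))) * ((v : Modes) m).2) := rfl

theorem IsPhaseSpace.evolution_apply (hV : IsPhaseSpace V) {t t₀ : ℝ} (ht : 0 < t) (ht₀ : 0 < t₀)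
    (v : V) (m : ℕ+) :
    (hV.evolution t t₀ ht ht₀ v : Modes) m =
      (alpha m t t₀ * ((v : Modes) m).1 + beta m t t₀ * conj ((v : Modes) m).2,
        alpha m t t₀ * ((v : Modes) m).2 + beta m t t₀ * conj ((v : Modes) m).1) := rfl

theorem innerRe_J0_self (hV : IsPhaseSpace V) (v : V) :
    innerRe hV.J0 v v = ∑' m, pairNormSq ((v : Modes) m) := by
  rw [innerRe, symp_eq_tsum, ← tsum_div_const]
  refine tsum_congr fun m => ?_
  rw [hV.J0_apply, pairForm_eq, pairNormSq_eq]
  simp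
  ring

theorem isCompatible_J0 (hV : IsPhaseSpace V) : IsCompatible hV.J0 where
  sq v := by
    refine Subtype.ext (funext fun m => ?_)
    rw [hV.J0_apply, hV.J0_apply]
    refine Prod.ext ?_ ?_
    · simp [← mul_assoc]
    · simp [← mul_assoc]
  symp_eq v w := by
    rw [symp_eq_tsum, symp_eq_tsum]
    refine tsum_congr fun m => ?_
    rw [hV.J0_apply, hV.J0_apply, pairForm_eq, pairForm_eq]
    simp
    ring
  pos v hv := by
    have h1 : symp (hV.J0 v : Modes) (v : Modes) = 2 * ∑' m, pairNormSq ((v : Modes) m) := by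
      rw [← innerRe_J0_self hV, innerRe]
      ring
    have h2 : ∃ m, (v : Modes) m ≠ 0 := by
      by_contra! h
      exact hv (Subtype.ext (funext h))
    obtain ⟨m, hm⟩ := h2
    have h3 : 0 < pairNormSq ((v : Modes) m) := by
      rcases eq_or_ne ((v : Modes) m).1 0 with h | h
      · have h4 : ((v : Modes) m).2 ≠ 0 := fun h5 => hm (Prod.ext h h5)
        unfold pairNormSq
        have := norm_pos_iff.2 h4
        positivity
      · unfold pairNormSq
        have := norm_pos_iff.2 h
        positivity
    rw [h1]
    have := (hV.summable_pairNormSq v).tsum_pos (fun m => pairNormSq_nonneg _) m h3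
    linarith

theorem isInvariant_J0 (hV : IsPhaseSpace V) : IsInvariant hV hV.J0 := by
  intro θ v
  refine Subtype.ext (funext fun m => ?_)
  rw [hV.translation_apply, hV.J0_apply, hV.translation_apply, hV.J0_apply]
  refine Prod.ext ?_ ?_
  · have : Complex.exp (Complex.I * ((m : ℝ) * -θ : ℝ)) * Complex.exp (Complex.I * ((m : ℝ) * θ : ℝ))
        = 1 := by
      rw [← Complex.exp_add, ← Complex.exp_zero]
      congr 1
      push_cast
      ring
    linear_combination (Complex.I * ((v : Modes) m).1) * this
  · have : Complex.exp (-(Complex.I * ((m : ℝ) * -θ : ℝ))) *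
        Complex.exp (-(Complex.I * ((m : ℝ) * θ : ℝ))) = 1 := by
      rw [← Complex.exp_add, ← Complex.exp_zero]
      congr 1
      push_cast
      ring
    linear_combination (Complex.I * ((v : Modes) m).2) * this

/-! ### Hilbert-Schmidt operators that are diagonal in the modes -/

theorem sum_sq_le_of_orthonormal {E : Type*} [AddCommGroup E] [Module ℝ E] (B : E →ₗ[ℝ] E →ₗ[ℝ] ℝ)
    (hsymm : ∀ x y, B x y = B y x) (hpos : ∀ x, 0 ≤ B x x) {n : ℕ} (e : Fin n → E)
    (he : ∀ i j, B (e i) (e j) = if i = j then 1 else 0) (x : E) :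
    ∑ i, B (e i) x ^ 2 ≤ B x x := by
  have h := hpos (x - ∑ i, B (e i) x • e i)
  have h1 : B (∑ i, B (e i) x • e i) x = ∑ i, B (e i) x ^ 2 := by
    simp [map_sum, LinearMap.sum_apply, sq]
  have h2 : B (∑ i, B (e i) x • e i) (∑ i, B (e i) x • e i) = ∑ i, B (e i) x ^ 2 := by
    simp [map_sum, LinearMap.sum_apply, sq, he]
  have h3 := hsymm x (∑ i, B (e i) x • e i)
  simp only [map_sub, LinearMap.sub_apply] at h
  linarith

/-- Bessel's inequality against the four real unit vectors of one pair of modes, each contributing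
at most 1. -/
theorem sum_pairNormSq_le (hV : IsPhaseSpace V) {n : ℕ} (e : Fin n → V)
    (he : ∀ i j, innerRe hV.J0 (e i) (e j) = if i = j then 1 else 0) (m : ℕ+) :
    ∑ i, pairNormSq ((e i : Modes) m) ≤ 4 := by
  set B : V →ₗ[ℝ] V →ₗ[ℝ] ℝ := (1 / 2 : ℝ) • hV.form ∘ₗ hV.J0
  have hB : ∀ v w, B v w = innerRe hV.J0 v w := fun v w => by
    simp only [B, innerRe, LinearMap.smul_apply, LinearMap.comp_apply, hV.form_apply, smul_eq_mul]
    ring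
  have hsymm : ∀ v w, B v w = B w v := fun v w => by
    rw [hB, hB, innerRe, innerRe, symp_eq_tsum, symp_eq_tsum]
    congr 1
    refine tsum_congr fun m => ?_
    rw [hV.J0_apply, hV.J0_apply, pairForm_eq, pairForm_eq]
    simp
    ring
  have hpos : ∀ v, 0 ≤ B v v := fun v => by
    rw [hB, innerRe_J0_self]
    exact tsum_nonneg fun m => pairNormSq_nonneg _
  have hbes := fun z => sum_sq_le_of_orthonormal B hsymm hpos e
    (fun i j => by rw [hB, he]) (hV.single m z)
  have hval : ∀ v z, B v (hV.single m z) = ((v : Modes) m).1.re * z.1.re +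
      ((v : Modes) m).1.im * z.1.im + ((v : Modes) m).2.re * z.2.re +
      ((v : Modes) m).2.im * z.2.im := fun v z => by
    rw [hB, innerRe, hV.symp_single, hV.J0_apply, pairForm_eq]
    simp
    ring
  have h1 := hbes (1, 0)
  have h2 := hbes (Complex.I, 0)
  have h3 := hbes (0, 1)
  have h4 := hbes (0, Complex.I)
  simp only [hval, hV.single_same] at h1 h2 h3 h4
  simp at h1 h2 h3 h4
  simp only [pairNormSq_eq, Finset.sum_add_distrib]
  linarith

/-- Interchanging the two sums bounds the Hilbert-Schmidt sum by four times the sum of `K`,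
uniformly in the orthonormal family. -/
theorem isHilbertSchmidt_J0_of_bound (hV : IsPhaseSpace V) (A : V →ₗ[ℝ] V) {K : ℕ+ → ℝ}
    (hK : Summable K) (hK0 : ∀ m, 0 ≤ K m)
    (hA : ∀ (v : V) (m : ℕ+), pairNormSq ((A v : Modes) m) ≤ K m * pairNormSq ((v : Modes) m)) :
    IsHilbertSchmidt hV.J0 A := by
  refine ⟨∑' m, K m * 4, fun n e he => ?_⟩
  have h4 := sum_pairNormSq_le hV e he
  have hle : ∀ i m, K m * pairNormSq ((e i : Modes) m) ≤ K m * 4 := fun i m =>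
    mul_le_mul_of_nonneg_left ((Finset.single_le_sum (f := fun i => pairNormSq ((e i : Modes) m))
      (fun i _ => pairNormSq_nonneg _) (Finset.mem_univ i)).trans (h4 m)) (hK0 m)
  have hs : ∀ i, Summable fun m => K m * pairNormSq ((e i : Modes) m) := fun i =>
    Summable.of_nonneg_of_le (fun m => mul_nonneg (hK0 m) (pairNormSq_nonneg _)) (hle i)
      (hK.mul_right 4)
  calc ∑ i, innerRe hV.J0 (A (e i)) (A (e i))
      ≤ ∑ i, ∑' m, K m * pairNormSq ((e i : Modes) m) := by
        refine Finset.sum_le_sum fun i _ => ?_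
        rw [innerRe_J0_self]
        exact (hV.summable_pairNormSq _).tsum_le_tsum (fun m => hA (e i) m) (hs i)
    _ = ∑' m, ∑ i, K m * pairNormSq ((e i : Modes) m) :=
        (Summable.tsum_finsetSum fun i _ => hs i).symm
    _ ≤ ∑' m, K m * 4 := by
        refine (summable_sum fun i _ => hs i).tsum_le_tsum (fun m => ?_) (hK.mul_right 4)
        rw [← Finset.mul_sum]
        exact mul_le_mul_of_nonneg_left (h4 m) (hK0 m)

theorem dynamicsImplementable_J0 (hV : IsPhaseSpace V) : DynamicsImplementable hV hV.J0 := by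
  intro t t₀ ht ht₀
  refine isHilbertSchmidt_J0_of_bound hV _ (summable_norm_beta_sq ht ht₀) (fun m => sq_nonneg _)
    fun v m => le_of_eq ?_
  have h1 : (antilinearPart hV.J0 (hV.evolution t t₀ ht ht₀) v : Modes) m =
      (beta m t t₀ * conj ((v : Modes) m).2, beta m t t₀ * conj ((v : Modes) m).1) := by
    change (1 / 2 : ℝ) • ((hV.evolution t t₀ ht ht₀ v : Modes) m +
      (hV.J0 (hV.evolution t t₀ ht ht₀ (hV.J0 v)) : Modes) m) = _
    rw [hV.J0_apply, hV.evolution_apply, hV.evolution_apply, hV.J0_apply]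
    refine Prod.ext ?_ ?_
    · simp only [Prod.smul_fst, Prod.fst_add, Complex.real_smul, map_mul, Complex.conj_I]
      push_cast
      linear_combination (1 / 2 * (alpha m t t₀ * ((v : Modes) m).1 -
        beta m t t₀ * conj ((v : Modes) m).2)) * Complex.I_sq
    · simp only [Prod.smul_snd, Prod.snd_add, Complex.real_smul, map_mul, Complex.conj_I]
      push_cast
      linear_combination (1 / 2 * (alpha m t t₀ * ((v : Modes) m).2 -
        beta m t t₀ * conj ((v : Modes) m).1)) * Complex.I_sq
  rw [h1, pairNormSq, pairNormSq]
  simp only [norm_mul, Complex.norm_conj]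
  ring

/-! ### Invariant complex structures are diagonal in the modes -/

theorem IsInvariant.comm {hV : IsPhaseSpace V} {J : V →ₗ[ℝ] V} (hJ : IsInvariant hV J) (θ : ℝ)
    (v : V) : J (hV.translation θ v) = hV.translation θ (J v) := by
  rw [← hJ θ v]
  refine Subtype.ext (funext fun m => ?_)
  rw [hV.translation_apply, hV.translation_apply]
  refine Prod.ext ?_ ?_
  · rw [← mul_assoc, ← Complex.exp_add]
    simp
  · rw [← mul_assoc, ← Complex.exp_add]
    simp [← Complex.exp_add, ← mul_assoc]

/-- J is only real linear, so translation eigenvalues cannot be used directly. On the m-th pair,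
however, T_{2θ} + 1 = 2 cos(mθ) T_θ has a real coefficient, and J preserves this relation. In the
n-th pair it can hold only for the zero vector once cos(nθ) ≠ cos(mθ). -/
theorem IsInvariant.single_of_ne {hV : IsPhaseSpace V} {J : V →ₗ[ℝ] V} (hJ : IsInvariant hV J)
    {m n : ℕ+} (hmn : n ≠ m) (z : ℂ × ℂ) : (J (hV.single m z) : Modes) n = 0 := by
  have hm := one_le_cast m
  have hn := one_le_cast n
  -- This puts nθ and mθ in [0, π], where the cosine is injective.
  set θ := Real.pi / ((n : ℝ) + m)
  have hp := Real.pi_pos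
  have hcos : ∀ x : ℝ, Complex.exp (Complex.I * (2 * x : ℝ)) + 1 =
      (2 * Real.cos x : ℝ) * Complex.exp (Complex.I * x) := fun x => by
    push_cast
    rw [Complex.two_cos, add_mul, ← Complex.exp_add, ← Complex.exp_add]
    congr 1
    · congr 1
      ring
    · rw [← Complex.exp_zero]
      congr 1
      ring
  have hcos' : ∀ x : ℝ, Complex.exp (-(Complex.I * (2 * x : ℝ))) + 1 =
      (2 * Real.cos x : ℝ) * Complex.exp (-(Complex.I * x)) := fun x => by
    have := hcos (-x)
    rw [Real.cos_neg] at this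
    push_cast at this ⊢
    convert this using 3 <;> ring_nf
  set v := hV.single m z
  have h1 : hV.translation (2 * θ) v + v = (2 * Real.cos (m * θ)) • hV.translation θ v := by
    refine Subtype.ext (funext fun k => ?_)
    change (hV.translation (2 * θ) v : Modes) k + (v : Modes) k =
      (2 * Real.cos (m * θ)) • (hV.translation θ v : Modes) k
    rw [hV.translation_apply, hV.translation_apply]
    rcases eq_or_ne k m with rfl | hk
    · have e1 := hcos (k * θ)
      have e2 := hcos' (k * θ)
      rw [show 2 * ((k : ℝ) * θ) = k * (2 * θ) by ring] at e1 e2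
      refine Prod.ext ?_ ?_
      · simp only [Prod.fst_add, Prod.smul_fst, Complex.real_smul]
        linear_combination ((v : Modes) k).1 * e1
      · simp only [Prod.snd_add, Prod.smul_snd, Complex.real_smul]
        linear_combination ((v : Modes) k).2 * e2
    · rw [hV.single_of_ne hk]
      simp
  have h2 := congrArg J h1
  rw [map_add, map_smul, hJ.comm, hJ.comm] at h2
  have h3 : (hV.translation (2 * θ) (J v) : Modes) n + (J v : Modes) n =
      (2 * Real.cos (m * θ)) • (hV.translation θ (J v) : Modes) n :=
    congrFun (congrArg Subtype.val h2) n
  rw [hV.translation_apply, hV.translation_apply] at h3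
  have hne : Real.cos (n * θ) - Real.cos (m * θ) ≠ 0 := fun h => by
    have hx : ∀ k : ℕ+, (k : ℝ) ≤ n + m → (k : ℝ) * θ ∈ Icc 0 Real.pi := fun k hk => by
      have hk1 := one_le_cast k
      refine ⟨by positivity, ?_⟩
      rw [← mul_div_assoc, div_le_iff₀ (by positivity)]
      nlinarith
    have := Real.injOn_cos (hx n (by linarith)) (hx m (by linarith)) (sub_eq_zero.1 h)
    have h5 : (n : ℝ) = m := mul_right_cancel₀ (by positivity : θ ≠ 0) this
    exact hmn (PNat.coe_injective (by exact_mod_cast h5))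
  have hne' : ((Real.cos (n * θ) - Real.cos (m * θ) : ℝ) : ℂ) ≠ 0 := by exact_mod_cast hne
  have e1 := hcos (n * θ)
  have e2 := hcos' (n * θ)
  rw [show 2 * ((n : ℝ) * θ) = n * (2 * θ) by ring] at e1 e2
  refine Prod.ext ?_ ?_
  · have h4 := congrArg Prod.fst h3
    simp only [Prod.fst_add, Prod.smul_fst, Complex.real_smul] at h4
    have h5 : ((Real.cos (n * θ) - Real.cos (m * θ) : ℝ) : ℂ) *
        Complex.exp (Complex.I * ((n : ℝ) * θ : ℝ)) * ((J v : Modes) n).1 = 0 := by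
      rw [Complex.ofReal_sub]
      rw [Complex.ofReal_mul 2, Complex.ofReal_ofNat] at e1 h4
      linear_combination 1 / 2 * h4 - 1 / 2 * ((J v : Modes) n).1 * e1
    simpa [hne', Complex.exp_ne_zero, -Complex.ofReal_sub] using h5
  · have h4 := congrArg Prod.snd h3
    simp only [Prod.snd_add, Prod.smul_snd, Complex.real_smul] at h4
    have h5 : ((Real.cos (n * θ) - Real.cos (m * θ) : ℝ) : ℂ) *
        Complex.exp (-(Complex.I * ((n : ℝ) * θ : ℝ))) * ((J v : Modes) n).2 = 0 := by
      rw [Complex.ofReal_sub]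
      rw [Complex.ofReal_mul 2, Complex.ofReal_ofNat] at e2 h4
      linear_combination 1 / 2 * h4 - 1 / 2 * ((J v : Modes) n).2 * e2
    simpa [hne', Complex.exp_ne_zero, -Complex.ofReal_sub] using h5

theorem IsCompatible.symp_left {J : V →ₗ[ℝ] V} (hV : IsPhaseSpace V) (hJ : IsCompatible J)
    (v w : V) : symp (J v : Modes) (w : Modes) = -symp (v : Modes) (J w : Modes) := by
  rw [← hJ.symp_eq, hJ.sq, ← hV.form_apply, ← hV.form_apply, map_neg, LinearMap.neg_apply]

/-- Elements of V may have infinitely many modes and J is not assumed continuous, so its action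
cannot be summed over modes. Instead J is moved by skewness onto a test vector in the m-th pair,
whose image stays in that pair. -/
theorem IsCompatible.apply_eq_single {hV : IsPhaseSpace V} {J : V →ₗ[ℝ] V} (hJ : IsCompatible J)
    (hI : IsInvariant hV J) (v : V) (m : ℕ+) :
    (J v : Modes) m = (J (hV.single m ((v : Modes) m)) : Modes) m := by
  refine eq_of_pairForm_eq fun z => ?_
  have hsupp : ∀ n, n ≠ m → (J (hV.single m z) : Modes) n = 0 := fun n hn => hI.single_of_ne hn z
  rw [← hV.symp_single, ← hV.symp_single, hJ.symp_left hV, hJ.symp_left hV,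
    symp_eq_pairForm_of_right m _ _ hsupp, symp_eq_pairForm_of_right m _ _ hsupp, hV.single_same]

/-- A compatible complex structure on one pair of modes, in hyperbolic parametrization. -/
noncomputable def pairJ (κ : ℝ) (l : ℂ) (z : ℂ × ℂ) : ℂ × ℂ :=
  (Complex.I * (κ ^ 2 + l * conj l) * z.1 - 2 * Complex.I * κ * l * conj z.2,
    Complex.I * (κ ^ 2 + l * conj l) * z.2 - 2 * Complex.I * κ * l * conj z.1)

/-- Commuting with the rotation makes j complex linear in (z_1, z_2^*). Skewness makes the diagonal
entries imaginary and the off-diagonal ones equal. Then j² = -1 and positivity equate the diagonal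
entries to a common ia with a² = 1 + |q|². -/
theorem exists_pairJ (j : ℂ × ℂ →ₗ[ℝ] ℂ × ℂ)
    (hrot : ∀ z, j (Complex.I * z.1, -Complex.I * z.2) = (Complex.I * (j z).1, -Complex.I * (j z).2))
    (hsymp : ∀ z w, pairForm (j z) w = -pairForm z (j w)) (hsq : ∀ z, j (j z) = -z)
    (hpos : ∀ z, z ≠ 0 → 0 < pairForm (j z) z) :
    ∃ (κ : ℝ) (l : ℂ), 1 ≤ κ ∧ κ ^ 2 = 1 + ‖l‖ ^ 2 ∧ ∀ z, j z = pairJ κ l z := by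
  set p := (j (1, 0)).1
  set q := (j (1, 0)).2
  set r := (j (0, 1)).1
  set s := (j (0, 1)).2
  have h10 : j (1, 0) = (p, q) := rfl
  have h01 : j (0, 1) = (r, s) := rfl
  have hI0 : j (Complex.I, 0) = (Complex.I * p, -Complex.I * q) := by
    simpa [h10] using hrot (1, 0)
  have h0I : j (0, Complex.I) = (-Complex.I * r, Complex.I * s) := by
    have h := hrot (0, 1)
    simp only [mul_zero, mul_one, h01] at h
    have h2 : ((0, Complex.I) : ℂ × ℂ) = -(0, -Complex.I) := by simp
    rw [h2, map_neg, h]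
    simp
  have hj : ∀ z : ℂ × ℂ, j z = (p * z.1 + r * conj z.2, q * conj z.1 + s * z.2) := by
    intro z
    have hz : z = z.1.re • ((1, 0) : ℂ × ℂ) + z.1.im • ((Complex.I, 0) : ℂ × ℂ) +
        z.2.re • ((0, 1) : ℂ × ℂ) + z.2.im • ((0, Complex.I) : ℂ × ℂ) := by
      refine Prod.ext ?_ ?_
      · simp
      · simp
    have h1 := Complex.re_add_im z.1
    have h2 := Complex.re_add_im z.2
    have h3 : conj z.1 = z.1.re - z.1.im * Complex.I := Complex.ext (by simp) (by simp)
    have h4 : conj z.2 = z.2.re - z.2.im * Complex.I := Complex.ext (by simp) (by simp)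
    conv_lhs => rw [hz]
    rw [map_add, map_add, map_add, map_smul, map_smul, map_smul, map_smul, h10, h01, hI0, h0I]
    refine Prod.ext ?_ ?_
    · simp only [Prod.fst_add, Prod.smul_fst, Complex.real_smul]
      rw [h4]
      linear_combination p * h1
    · simp only [Prod.snd_add, Prod.smul_snd, Complex.real_smul]
      rw [h3]
      linear_combination s * h2
  have hp := hsymp (1, 0) (Complex.I, 0)
  have hs := hsymp (0, 1) (0, Complex.I)
  have hqr := hsymp (1, 0) (0, 1)
  have hqr' := hsymp (1, 0) (0, Complex.I)
  have ha := hpos (1, 0) (by simp)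
  have hb := hpos (0, 1) (by simp)
  have hsq1 := hsq (1, 0)
  have hsq2 := hsq (0, 1)
  simp only [hj, pairForm_eq] at hp hs hqr hqr' ha hb
  simp at hp hs hqr hqr' ha hb
  have hrq : r = q := Complex.ext (by linarith) (by linarith)
  have hp' : p = p.im * Complex.I := Complex.ext (by simp; linarith) (by simp)
  have hs' : s = s.im * Complex.I := Complex.ext (by simp; linarith) (by simp)
  set a := p.im
  set b := s.im
  simp only [hj, hrq, hp', hs'] at hsq1 hsq2
  have hsq1' := congrArg (fun z : ℂ × ℂ => z.1.re) hsq1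
  have hsq2' := congrArg (fun z : ℂ × ℂ => z.2.re) hsq2
  simp at hsq1' hsq2'
  have hab : a = b := by
    have : a ^ 2 = b ^ 2 := by linarith
    exact (sq_eq_sq₀ ha.le hb.le).1 this
  have hk : ‖q‖ ^ 2 = a ^ 2 - 1 := by
    rw [Complex.sq_norm, Complex.normSq_apply]
    linarith
  have ha1 : 1 ≤ a := by nlinarith [sq_nonneg ‖q‖]
  -- The hyperbolic half-angle: κ² + |l|² = 2κ² - 1 must equal a, and -2iκl must equal q.
  set κ := √((1 + a) / 2)
  have hκ : κ ^ 2 = (1 + a) / 2 := Real.sq_sqrt (by linarith)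
  have hκ1 : 1 ≤ κ := Real.one_le_sqrt.2 (by linarith)
  have hκ0 : (κ : ℂ) ≠ 0 := by exact_mod_cast (by linarith : κ ≠ 0)
  have hl : ‖Complex.I * q / (2 * κ)‖ ^ 2 = κ ^ 2 - 1 := by
    rw [norm_div, norm_mul, norm_mul, Complex.norm_I, Complex.norm_ofNat, Complex.norm_real,
      Real.norm_of_nonneg (by linarith), one_mul, div_pow, mul_pow, hk, hκ]
    field_simp
    ring
  refine ⟨κ, Complex.I * q / (2 * κ), hκ1, by rw [hl]; ring, fun z => ?_⟩
  have hc : (κ : ℂ) ^ 2 + Complex.I * q / (2 * κ) * conj (Complex.I * q / (2 * κ)) = a := by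
    rw [Complex.mul_conj, Complex.normSq_eq_norm_sq, hl]
    have : κ ^ 2 + (κ ^ 2 - 1) = a := by rw [hκ]; ring
    exact_mod_cast this
  have hd : 2 * Complex.I * κ * (Complex.I * q / (2 * κ)) = -q := by
    field_simp
    linear_combination q * Complex.I_sq
  rw [hj, pairJ, hc, hd, hrq, hp', hs', hab]
  refine Prod.ext ?_ ?_
  · simp only
    ring
  · simp only
    ring

theorem IsCompatible.exists_pairJ {hV : IsPhaseSpace V} {J : V →ₗ[ℝ] V} (hJ : IsCompatible J)
    (hI : IsInvariant hV J) (m : ℕ+) : ∃ (κ : ℝ) (l : ℂ), 1 ≤ κ ∧ κ ^ 2 = 1 + ‖l‖ ^ 2 ∧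
      ∀ v : V, (J v : Modes) m = pairJ κ l ((v : Modes) m) := by
  let j : ℂ × ℂ →ₗ[ℝ] ℂ × ℂ :=
    { toFun := fun z => (J (hV.single m z) : Modes) m
      map_add' := fun z w => by
        have : hV.single m (z + w) = hV.single m z + hV.single m w :=
          Subtype.ext (by simp [IsPhaseSpace.single, Pi.single_add])
        rw [this, map_add]
        rfl
      map_smul' := fun r z => by
        have : hV.single m (r • z) = r • hV.single m z :=
          Subtype.ext (by simp [IsPhaseSpace.single, Pi.single_smul])
        rw [this, map_smul]
        rfl }
  have hsupp : ∀ z n, n ≠ m → (J (hV.single m z) : Modes) n = 0 := fun z n hn =>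
    hI.single_of_ne hn z
  have hJs : ∀ z, J (hV.single m z) = hV.single m (j z) := fun z => by
    refine Subtype.ext (funext fun n => ?_)
    rcases eq_or_ne n m with rfl | hn
    · rw [hV.single_same]
      rfl
    · rw [hsupp z n hn, hV.single_of_ne hn]
  suffices h : ∃ (κ : ℝ) (l : ℂ), 1 ≤ κ ∧ κ ^ 2 = 1 + ‖l‖ ^ 2 ∧ ∀ z, j z = pairJ κ l z by
    obtain ⟨κ, l, h1, h2, h3⟩ := h
    exact ⟨κ, l, h1, h2, fun v => (hJ.apply_eq_single hI v m).trans (h3 _)⟩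
  refine Gowdy.exists_pairJ j ?_ ?_ ?_ ?_
  · intro z
    -- On the m-th pair this translation is a quarter turn.
    have hrot : ∀ w, hV.translation (Real.pi / 2 / m) (hV.single m w) =
        hV.single m (Complex.I * w.1, -Complex.I * w.2) := fun w => by
      refine Subtype.ext (funext fun n => ?_)
      rw [hV.translation_apply]
      rcases eq_or_ne n m with rfl | hn
      · have hn0 : (n : ℝ) ≠ 0 := by linarith [one_le_cast n]
        rw [hV.single_same, hV.single_same, mul_div_cancel₀ _ hn0, ← mul_neg, ← Complex.ofReal_neg,
          mul_comm Complex.I, mul_comm Complex.I, Complex.exp_mul_I, Complex.exp_mul_I,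
          ← Complex.ofReal_cos, ← Complex.ofReal_sin, ← Complex.ofReal_cos, ← Complex.ofReal_sin,
          Real.cos_neg, Real.sin_neg, Real.cos_pi_div_two, Real.sin_pi_div_two]
        simp
      · rw [hV.single_of_ne hn, hV.single_of_ne hn]
        simp
    have h := hI.comm (Real.pi / 2 / m) (hV.single m z)
    rw [hrot, hJs, hJs, hrot] at h
    have h' := congrFun (congrArg Subtype.val h) m
    rwa [hV.single_same, hV.single_same] at h'
  · intro z w
    have h := hJ.symp_left hV (hV.single m z) (hV.single m w)
    rwa [hJs, hJs, hV.symp_single, hV.symp_single, hV.single_same, hV.single_same] at h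
  · intro z
    have h := congrFun (congrArg Subtype.val (hJ.sq (hV.single m z))) m
    rw [hJs, hJs, hV.single_same] at h
    rw [h]
    change -(hV.single m z : Modes) m = -z
    rw [hV.single_same]
  · intro z hz
    have h := hJ.pos (hV.single m z) fun h0 => hz (by
      rw [← hV.single_same m z, h0]
      rfl)
    rwa [hJs, hV.symp_single, hV.single_same] at h

/-! ### Test vectors for the unitarity of the dynamics -/

/-- The antilinear coefficient of the evolution with respect to `pairJ κ l`. -/
noncomputable def conjBeta (κ : ℝ) (l a b : ℂ) : ℂ :=
  κ ^ 2 * conj b - 2 * Complex.I * a.im * κ * conj l - b * conj l ^ 2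

/-- In the coordinates (b_m, b_{-m}^*) the block is complex linear: (κ, l^*) spans its eigenspace
for i, and (l, κ) in `pairJ_minus` the one for -i. -/
theorem pairJ_plus {κ : ℝ} {l : ℂ} (h : (κ : ℂ) ^ 2 = 1 + l * conj l) :
    pairJ κ l (κ, l) = (Complex.I * κ, -Complex.I * l) := by
  refine Prod.ext ?_ ?_
  · simp only [pairJ]
    linear_combination (Complex.I * κ) * h
  · simp only [pairJ, Complex.conj_ofReal]
    linear_combination (-Complex.I * l) * h

theorem pairJ_minus {κ : ℝ} {l : ℂ} (h : (κ : ℂ) ^ 2 = 1 + l * conj l) (g : ℂ) :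
    pairJ κ l (g * l, conj g * κ) = (-Complex.I * (g * l), Complex.I * (conj g * κ)) := by
  refine Prod.ext ?_ ?_
  · simp only [pairJ, map_mul, Complex.conj_ofReal, Complex.conj_conj]
    linear_combination (-Complex.I * g * l) * h
  · simp only [pairJ, map_mul]
    linear_combination (Complex.I * conj g * κ) * h

/-- The antilinear part anticommutes with J, so it carries the eigenvector for i into the eigenspace
for -i; `conjBeta` is the resulting matrix element. -/
theorem antilinear_test {κ : ℝ} {l : ℂ} (h : (κ : ℂ) ^ 2 = 1 + l * conj l) (a b : ℂ) :
    (1 / 2 : ℝ) • ((a * κ + b * conj l, a * l + b * κ) +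
      pairJ κ l (a * (Complex.I * κ) + b * conj (-Complex.I * l),
        a * (-Complex.I * l) + b * conj (Complex.I * κ))) =
      (conjBeta κ l a b * l, conj (conjBeta κ l a b) * κ) := by
  have him : (a.im : ℂ) * (2 * Complex.I) = a - conj a := by
    rw [Complex.sub_conj]
    push_cast
    ring
  have hg : conjBeta κ l a b = κ ^ 2 * conj b - (a - conj a) * κ * conj l - b * conj l ^ 2 := by
    rw [conjBeta, ← him]
    ring
  have hgc : conj (conjBeta κ l a b) = κ ^ 2 * b + (a - conj a) * κ * l - conj b * l ^ 2 := by
    rw [hg]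
    simp only [map_sub, map_mul, map_pow, Complex.conj_ofReal, Complex.conj_conj]
    ring
  rw [hgc, hg]
  refine Prod.ext ?_ ?_
  · simp only [pairJ, Prod.smul_fst, Prod.fst_add, Complex.real_smul, map_add, map_mul, map_neg,
      Complex.conj_I, Complex.conj_ofReal, Complex.conj_conj]
    push_cast
    linear_combination (-(a * κ + b * conj l) / 2) * h + (1 / 2 * (κ ^ 2 + l * conj l) *
      (a * κ + b * conj l) - κ * l * (conj a * conj l + conj b * κ)) * Complex.I_sq
  · simp only [pairJ, Prod.smul_snd, Prod.snd_add, Complex.real_smul, map_add, map_mul, map_neg,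
      Complex.conj_I, Complex.conj_ofReal, Complex.conj_conj]
    push_cast
    linear_combination (-(a * l + b * κ) / 2) * h + (-(1 / 2) * (κ ^ 2 + l * conj l) *
      (a * l + b * κ) + κ * l * (conj a * κ + conj b * l)) * Complex.I_sq

theorem pairForm_I_self (x y : ℂ) :
    pairForm (Complex.I * x, -Complex.I * y) (x, y) = 2 * (‖x‖ ^ 2 - ‖y‖ ^ 2) := by
  rw [pairForm_eq, Complex.sq_norm, Complex.sq_norm, Complex.normSq_apply, Complex.normSq_apply]
  simp
  ring

theorem pairForm_neg_I_self (x y : ℂ) :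
    pairForm (-Complex.I * x, Complex.I * y) (x, y) = 2 * (‖y‖ ^ 2 - ‖x‖ ^ 2) := by
  rw [pairForm_eq, Complex.sq_norm, Complex.sq_norm, Complex.normSq_apply, Complex.normSq_apply]
  simp
  ring

theorem pairJ_zero (κ : ℝ) (l : ℂ) : pairJ κ l 0 = 0 := by simp [pairJ]

/-- The vectors (κ_m, l_m) are orthonormal for the inner product of J, and their images under the
antilinear part have squared norm |`conjBeta`|². The Hilbert-Schmidt bound on finite families bounds
all partial sums. -/
theorem summable_conjBeta (hV : IsPhaseSpace V) {J : V →ₗ[ℝ] V}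
    (hD : DynamicsImplementable hV J) {κ : ℕ+ → ℝ} {l : ℕ+ → ℂ}
    (hκ : ∀ m, κ m ^ 2 = 1 + ‖l m‖ ^ 2)
    (hJ : ∀ m (v : V), (J v : Modes) m = pairJ (κ m) (l m) ((v : Modes) m))
    {t t₀ : ℝ} (ht : 0 < t) (ht₀ : 0 < t₀) :
    Summable fun m => ‖conjBeta (κ m) (l m) (alpha m t t₀) (beta m t t₀)‖ ^ 2 := by
  have hκ' : ∀ m, (κ m : ℂ) ^ 2 = 1 + l m * conj (l m) := fun m => by
    rw [Complex.mul_conj, Complex.normSq_eq_norm_sq]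
    exact_mod_cast hκ m
  obtain ⟨C, hC⟩ := hD t t₀ ht ht₀
  set U := hV.evolution t t₀ ht ht₀
  set e : ℕ+ → V := fun m => hV.single m (κ m, l m)
  set g : ℕ+ → ℂ := fun m => conjBeta (κ m) (l m) (alpha m t t₀) (beta m t t₀)
  have horth : ∀ m n, innerRe J (e m) (e n) = if m = n then 1 else 0 := fun m n => by
    rw [innerRe, hV.symp_single, hJ]
    split_ifs with h
    · subst h
      rw [hV.single_same, pairJ_plus (hκ' m), pairForm_I_self, Complex.norm_real, Real.norm_eq_abs,
        sq_abs, hκ]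
      ring
    · rw [hV.single_of_ne (Ne.symm h), pairJ_zero, pairForm_zero_left, zero_div]
  have hA : ∀ m (v : V), (antilinearPart J U v : Modes) m = (1 / 2 : ℝ) •
      ((U v : Modes) m + pairJ (κ m) (l m) ((U (J v) : Modes) m)) := fun m v => by
    rw [← hJ]
    rfl
  have hval : ∀ m, innerRe J (antilinearPart J U (e m)) (antilinearPart J U (e m)) =
      ‖g m‖ ^ 2 := fun m => by
    have hoff : ∀ n, n ≠ m → (antilinearPart J U (e m) : Modes) n = 0 := fun n hn => by
      rw [hA, hV.evolution_apply, hV.evolution_apply, hJ, hV.single_of_ne hn, pairJ_zero]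
      simp [← Prod.zero_eq_mk, pairJ_zero]
    have hon : (antilinearPart J U (e m) : Modes) m =
        (g m * l m, conj (g m) * κ m) := by
      rw [hA, hV.evolution_apply, hV.evolution_apply, hJ, hV.single_same, pairJ_plus (hκ' m)]
      simp only [Complex.conj_ofReal]
      exact antilinear_test (hκ' m) _ _
    rw [innerRe, symp_eq_pairForm_of_right m _ _ hoff, hJ, hon, pairJ_minus (hκ' m),
      pairForm_neg_I_self, norm_mul, norm_mul, Complex.norm_conj, Complex.norm_real, mul_pow,
      mul_pow, Real.norm_eq_abs, sq_abs, hκ]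
    ring
  refine summable_of_sum_le (c := C) (fun m => sq_nonneg _) fun s => ?_
  have h := hC s.card (fun i => e (s.equivFin.symm i)) fun i j => by
    rw [horth]
    simp
  simp only [hval] at h
  rw [Equiv.sum_comp s.equivFin.symm (fun i : s => ‖g i‖ ^ 2),
    Finset.sum_coe_sort s (fun m => ‖g m‖ ^ 2)] at h
  exact h

/-! ### Square summability of the Bogoliubov coefficients and unitary equivalence. -/

/-- Solve `conjBeta` for its middle term, the only one with Im α, and divide by κ². Since |l| ≤ κ
and κ ≥ 1, this leaves 2|Im α| |l|/κ ≤ 2|b| + |`conjBeta`|. -/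
theorem im_sq_mul_le {κ : ℝ} {l : ℂ} (hκ1 : 1 ≤ κ) (hκ : κ ^ 2 = 1 + ‖l‖ ^ 2) (a b : ℂ) :
    ‖l‖ ^ 2 / κ ^ 2 * a.im ^ 2 ≤ ‖conjBeta κ l a b‖ ^ 2 + 2 * ‖b‖ ^ 2 := by
  have hκ0 : 0 < κ := by linarith
  have h1 : 2 * Complex.I * a.im * κ * conj l =
      κ ^ 2 * conj b - b * conj l ^ 2 - conjBeta κ l a b := by
    rw [conjBeta]
    ring
  have h2 : 2 * |a.im| * κ * ‖l‖ ≤ κ ^ 2 * ‖b‖ + ‖b‖ * ‖l‖ ^ 2 + ‖conjBeta κ l a b‖ := by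
    have h3 := congrArg norm h1
    rw [norm_mul, norm_mul, norm_mul, norm_mul, Complex.norm_I, Complex.norm_ofNat,
      Complex.norm_real, Complex.norm_real, Real.norm_eq_abs, Real.norm_eq_abs, abs_of_pos hκ0,
      Complex.norm_conj, mul_one] at h3
    rw [h3]
    refine (norm_sub_le _ _).trans (add_le_add_left ((norm_sub_le _ _).trans (le_of_eq ?_)) _)
    rw [norm_mul, norm_mul, norm_pow, norm_pow, Complex.norm_conj, Complex.norm_conj,
      Complex.norm_real, Real.norm_eq_abs, sq_abs]
  have h4 : 2 * |a.im| * κ * ‖l‖ ≤ κ ^ 2 * (2 * ‖b‖ + ‖conjBeta κ l a b‖) := by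
    nlinarith [norm_nonneg b, norm_nonneg (conjBeta κ l a b), sq_nonneg ‖l‖,
      mul_nonneg (norm_nonneg (conjBeta κ l a b)) (sq_nonneg ‖l‖)]
  have h5 : 2 * (|a.im| * (‖l‖ / κ)) ≤ 2 * ‖b‖ + ‖conjBeta κ l a b‖ := by
    have : 2 * (|a.im| * (‖l‖ / κ)) = 2 * |a.im| * κ * ‖l‖ / κ ^ 2 := by field_simp
    rw [this, div_le_iff₀ (by positivity)]
    linarith
  have h6 : ‖l‖ ^ 2 / κ ^ 2 * a.im ^ 2 = (|a.im| * (‖l‖ / κ)) ^ 2 := by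
    rw [mul_pow, sq_abs, div_pow]
    ring
  have h7 : 0 ≤ |a.im| * (‖l‖ / κ) := by positivity
  rw [h6]
  nlinarith [sq_nonneg (2 * ‖b‖ - ‖conjBeta κ l a b‖)]

theorem summable_ratio (hV : IsPhaseSpace V) {J : V →ₗ[ℝ] V}
    (hD : DynamicsImplementable hV J) {κ : ℕ+ → ℝ} {l : ℕ+ → ℂ} (hκ1 : ∀ m, 1 ≤ κ m)
    (hκ : ∀ m, κ m ^ 2 = 1 + ‖l m‖ ^ 2)
    (hJ : ∀ m (v : V), (J v : Modes) m = pairJ (κ m) (l m) ((v : Modes) m)) :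
    Summable fun m => ‖l m‖ ^ 2 / κ m ^ 2 := by
  refine summable_of_forall_summable_mul (f := fun m τ => (alpha m (120 + max τ 0) 120).im ^ 2)
    (fun m => by positivity) (fun m => ?_) (fun m τ => sq_nonneg _) (fun m τ hτ => ?_)
    fun τ hτ => ?_
  · exact (Complex.continuous_im.comp (continuous_alpha m (by norm_num))).pow 2
  · rw [max_eq_left hτ.1]
    have := (alpha_re_im_bounds (m := m) (t₀ := 120) (by norm_num) hτ.1).2
    norm_num at this ⊢
    linarith
  · have ht : (0 : ℝ) < 120 + max τ 0 := by linarith [le_max_right τ 0]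
    refine Summable.of_nonneg_of_le (fun m => by positivity)
      (fun m => im_sq_mul_le (hκ1 m) (hκ m) _ (beta m (120 + max τ 0) 120)) ?_
    exact (summable_conjBeta hV hD hκ hJ ht (by norm_num)).add
      ((summable_norm_beta_sq ht (by norm_num)).mul_left 2)

/-- The ratio is |l|²/(1 + |l|²), which controls |l|² only once it is small. As it tends to 0, all
but finitely many m satisfy |l|² ≤ 1 and |l|² ≤ 2 · ratio, whence 48 = 8 · 3 · 2. -/
theorem summable_norm_sq_of_ratio {κ : ℕ+ → ℝ} {l : ℕ+ → ℂ} (hκ : ∀ m, κ m ^ 2 = 1 + ‖l m‖ ^ 2)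
    (hs : Summable fun m => ‖l m‖ ^ 2 / κ m ^ 2) :
    Summable fun m => 8 * ‖l m‖ ^ 2 * (2 * ‖l m‖ ^ 2 + 1) := by
  refine Summable.of_norm_bounded_eventually (hs.mul_left 48) ?_
  filter_upwards [hs.tendsto_cofinite_zero.eventually_lt_const (by norm_num : (0 : ℝ) < 1 / 2)]
    with m hm
  have hpos : 0 < κ m ^ 2 := by
    rw [hκ]
    positivity
  have h1 : ‖l m‖ ^ 2 ≤ 1 := by
    rw [div_lt_iff₀ hpos, hκ] at hm
    linarith
  have h2 : ‖l m‖ ^ 2 ≤ 2 * (‖l m‖ ^ 2 / κ m ^ 2) := by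
    rw [← mul_div_assoc, le_div_iff₀ hpos, hκ]
    nlinarith [sq_nonneg ‖l m‖]
  rw [Real.norm_of_nonneg (by positivity)]
  nlinarith [sq_nonneg ‖l m‖]

/-- Because κ² - 1 = |l|², a factor l can be taken out of every entry of the difference. -/
theorem pairNormSq_pairJ_sub_le {κ : ℝ} {l : ℂ} (hκ : κ ^ 2 = 1 + ‖l‖ ^ 2) (z : ℂ × ℂ) :
    pairNormSq (pairJ κ l z - (Complex.I * z.1, Complex.I * z.2)) ≤
      8 * ‖l‖ ^ 2 * (2 * ‖l‖ ^ 2 + 1) * pairNormSq z := by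
  have hκ' : (κ : ℂ) ^ 2 = 1 + l * conj l := by
    rw [Complex.mul_conj, Complex.normSq_eq_norm_sq]
    exact_mod_cast hκ
  have hb : ∀ x y : ℂ, ‖Complex.I * (κ ^ 2 + l * conj l) * x - 2 * Complex.I * κ * l * conj y -
      Complex.I * x‖ ^ 2 ≤ 8 * ‖l‖ ^ 2 * (‖l‖ ^ 2 * ‖x‖ ^ 2 + κ ^ 2 * ‖y‖ ^ 2) := fun x y => by
    have h1 : Complex.I * (κ ^ 2 + l * conj l) * x - 2 * Complex.I * κ * l * conj y -
        Complex.I * x = 2 * Complex.I * l * (conj l * x - κ * conj y) := by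
      linear_combination Complex.I * x * hκ'
    have h2 : ‖conj l * x - κ * conj y‖ ≤ ‖l‖ * ‖x‖ + |κ| * ‖y‖ := by
      refine (norm_sub_le _ _).trans (le_of_eq ?_)
      rw [norm_mul, norm_mul, Complex.norm_conj, Complex.norm_conj, Complex.norm_real,
        Real.norm_eq_abs]
    have h3 : ‖conj l * x - κ * conj y‖ ^ 2 ≤ 2 * (‖l‖ ^ 2 * ‖x‖ ^ 2 + κ ^ 2 * ‖y‖ ^ 2) := by
      calc _ ≤ (‖l‖ * ‖x‖ + |κ| * ‖y‖) ^ 2 := by gcongr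
        _ ≤ 2 * ((‖l‖ * ‖x‖) ^ 2 + (|κ| * ‖y‖) ^ 2) := add_sq_le
        _ = _ := by rw [mul_pow, mul_pow, sq_abs]
    rw [h1, norm_mul, norm_mul, norm_mul, Complex.norm_I, Complex.norm_ofNat, mul_pow]
    nlinarith [sq_nonneg ‖l‖, mul_le_mul_of_nonneg_left h3 (sq_nonneg ‖l‖)]
  have h1 := hb z.1 z.2
  have h2 := hb z.2 z.1
  simp only [pairNormSq, pairJ, Prod.fst_sub, Prod.snd_sub]
  refine (add_le_add h1 h2).trans (le_of_eq ?_)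
  rw [hκ]
  ring

theorem fockEquivalentToJ0 (hV : IsPhaseSpace V) {J : V →ₗ[ℝ] V} (hJ : IsCompatible J)
    (hI : IsInvariant hV J) (hD : DynamicsImplementable hV J) : FockEquivalentToJ0 hV J := by
  choose κ l hκ1 hκ hJκ using fun m => hJ.exists_pairJ hI m
  refine isHilbertSchmidt_J0_of_bound hV _
    (summable_norm_sq_of_ratio hκ (summable_ratio hV hD hκ1 hκ hJκ))
    (fun m => by positivity) fun v m => ?_
  have h : ((J - hV.J0) v : Modes) m = pairJ (κ m) (l m) ((v : Modes) m) -
      (Complex.I * ((v : Modes) m).1, Complex.I * ((v : Modes) m).2) := by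
    rw [← hJκ]
    rfl
  rw [h]
  exact pairNormSq_pairJ_sub_le (hκ m) _

end Gowdy

theorem lemma2 :
    (∀ ε ∈ Set.Ioc (0 : ℝ) 1, ∃ T : ℝ, 0 < T ∧
      ∀ t₀ : ℝ, T < t₀ → ∀ τ ∈ Set.Icc (0 : ℝ) Real.pi, ∀ m : ℕ+,
        1 - (Gowdy.alpha m (t₀ + τ) t₀).re ^ 2 ≥ Real.sin ((m : ℝ) * τ) ^ 2 - 26 * ε) ∧
    Gowdy.Condition1 Gowdy.alpha ∧
    (∀ (V : Submodule ℝ Gowdy.Modes) (hV : Gowdy.IsPhaseSpace V),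
      (Gowdy.IsCompatible hV.J0 ∧ Gowdy.IsInvariant hV hV.J0 ∧
        Gowdy.DynamicsImplementable hV hV.J0) ∧
      ∀ J : V →ₗ[ℝ] V, Gowdy.IsCompatible J → Gowdy.IsInvariant hV J →
        Gowdy.DynamicsImplementable hV J → Gowdy.FockEquivalentToJ0 hV J) :=
  ⟨Gowdy.one_sub_sq_re_alpha_ge, Gowdy.condition1_alpha, fun _ hV =>
    ⟨⟨Gowdy.isCompatible_J0 hV, Gowdy.isInvariant_J0 hV, Gowdy.dynamicsImplementable_J0 hV⟩,
      fun _ hJ hI hD => Gowdy.fockEquivalentToJ0 hV hJ hI hD⟩⟩
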